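/- Let $n\ge 3$, $m\ge 0$, let $\tau\in\mathbb{C}^{m\times n}$ be any field transmission matrix and $T=\tau^\dagger\tau$ its transmittance matrix. Let $\mathbf a$ be drawn from the uniform distribution on the complex unit sphere $\{\mathbf z\in\mathbb{C}^n:|\mathbf z|=1\}$, and let $t=\mathbf a^\dagger T\mathbf a\in\mathbb{R}$ be the transmissivity, with mean $\mu=\mathbb{E}[t]$, variance $\sigma^2=\mathbb{E}[(t-\mu)^2]$ and standard deviation $\sigma\ge 0$. Then: 1. If $T$ is not a scalar multiple of the identity, the law of $t$ has a probability density function $p_n$ with respect to Lebesgue measure that is unimodal: there is $M\in\mathbb{R}$ such that $p_n$ is nondecreasing on $(-\infty,M]$ and nonincreasing on $[M,\infty)$. 2. $\displaystyle P(t<t_a)\le \frac49\,\frac{\sigma^2}{\sigma^2+(\mu-t_a)^2}$ for every real $t_a<\mu-\sqrt{5/3}\,\sigma$. 3. $\displaystyle P(t>t_b)\le \frac49\,\frac{\sigma^2}{\sigma^2+(t_b-\mu)^2}$ for every real $t_b>\mu+\sqrt{5/3}\,\sigma$. 4. (One-sided $3\sigma$ rule) $P(\mu-t>3\sigma)\le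 0.0445$ and $P(t-\mu>3\sigma)\le 0.0445$. -/

import Mathlib

open MeasureTheory ProbabilityTheory Set Matrix

noncomputable section

/-- The complex unit sphere in `ℂⁿ`, with the Euclidean norm. -/
abbrev ComplexSphere (n : ℕ) : Type :=
  Metric.sphere (0 : EuclideanSpace ℂ (Fin n)) 1

/-- The uniform distribution on the complex unit sphere: the surface measure induced by Lebesgue
measure on `ℂⁿ = ℝ²ⁿ`, divided by its total mass. -/
def uniformSphere (n : ℕ) : Measure (ComplexSphere n) :=
  ((volume : Measure (EuclideanSpace ℂ (Fin n))).toSphere univ)⁻¹ •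
    (volume : Measure (EuclideanSpace ℂ (Fin n))).toSphere

/-- The transmittance matrix `T = τ† τ` of the field transmission matrix `τ`. -/
def transmittanceMatrix {m n : ℕ} (τ : Matrix (Fin m) (Fin n) ℂ) : Matrix (Fin n) (Fin n) ℂ :=
  τᴴ * τ

/-- The transmissivity `t[a] = a† T a` of a normalized input `a`. The complex number `a† T a` is
real (see `transmissivity_eq`), and `Complex.re` only changes its type. -/
def transmissivity {m n : ℕ} (τ : Matrix (Fin m) (Fin n) ℂ) (a : ComplexSphere n) : ℝ :=
  (star (a : EuclideanSpace ℂ (Fin n)).ofLp ⬝ᵥ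
    (transmittanceMatrix τ *ᵥ (a : EuclideanSpace ℂ (Fin n)).ofLp)).re

/-- The probability distribution of the transmissivity `t[a]` of a uniformly random unit input. -/
def transmissivityLaw {m n : ℕ} (τ : Matrix (Fin m) (Fin n) ℂ) : Measure ℝ :=
  (uniformSphere n).map (transmissivity τ)

/-- The mean `μ` of the transmissivity. -/
def transmissivityMean {m n : ℕ} (τ : Matrix (Fin m) (Fin n) ℂ) : ℝ :=
  ∫ t, t ∂(transmissivityLaw τ)

/-- The variance `σ²` of the transmissivity. -/
def transmissivityVar {m n : ℕ} (τ : Matrix (Fin m) (Fin n) ℂ) : ℝ :=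
  ∫ t, (t - transmissivityMean τ) ^ 2 ∂(transmissivityLaw τ)

/-- The standard deviation `σ` of the transmissivity. -/
def transmissivityStd {m n : ℕ} (τ : Matrix (Fin m) (Fin n) ℂ) : ℝ :=
  √(transmissivityVar τ)

/-- `p` is a probability density function of the measure `ν` on the real line. -/
structure IsDensityOf (p : ℝ → ℝ) (ν : Measure ℝ) : Prop where
  measurable : Measurable p
  nonneg : ∀ t, 0 ≤ p t
  eq_withDensity : ν = volume.withDensity fun t => ENNReal.ofReal (p t)

/-- A function on the real line is unimodal if it is nondecreasing up to some point (a mode) and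
nonincreasing from there on. -/
def IsUnimodal (p : ℝ → ℝ) : Prop :=
  ∃ M : ℝ, MonotoneOn p (Iic M) ∧ AntitoneOn p (Ici M)

open scoped ComplexOrder in
theorem transmissivity_eq {m n : ℕ} (τ : Matrix (Fin m) (Fin n) ℂ) (a : ComplexSphere n) :
    ((transmissivity τ a : ℝ) : ℂ) =
      star (a : EuclideanSpace ℂ (Fin n)).ofLp ⬝ᵥ
        (transmittanceMatrix τ *ᵥ (a : EuclideanSpace ℂ (Fin n)).ofLp) := by
  have h := (Matrix.posSemidef_conjTranspose_mul_self τ).dotProduct_mulVec_nonneg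
    (a : EuclideanSpace ℂ (Fin n)).ofLp
  have h2 := (Complex.nonneg_iff.mp h).2
  apply Complex.ext
  · simp [transmissivity]
  · simpa [transmittanceMatrix] using h2

theorem continuous_transmissivity {m n : ℕ} (τ : Matrix (Fin m) (Fin n) ℂ) :
    Continuous (transmissivity τ) := by
  unfold transmissivity
  have h : Continuous fun a : ComplexSphere n => (a : EuclideanSpace ℂ (Fin n)).ofLp :=
    (PiLp.continuous_ofLp 2 _).comp continuous_subtype_val
  exact Complex.continuous_re.comp (h.star.dotProduct (continuous_const.matrix_mulVec h))

theorem isProbabilityMeasure_uniformSphere {n : ℕ} (hn : 1 ≤ n) :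
    IsProbabilityMeasure (uniformSphere n) := by
  have : Nonempty (Fin n) := ⟨⟨0, hn⟩⟩
  constructor
  have h0 : (volume : Measure (EuclideanSpace ℂ (Fin n))).toSphere univ ≠ 0 := by
    rw [Measure.toSphere_apply_univ]
    refine mul_ne_zero ?_ (Metric.measure_ball_pos _ _ one_pos).ne'
    exact_mod_cast (Module.finrank_pos (R := ℝ) (M := EuclideanSpace ℂ (Fin n))).ne'
  rw [uniformSphere, Measure.smul_apply, smul_eq_mul,
    ENNReal.inv_mul_cancel h0 (measure_ne_top _ _)]

theorem isProbabilityMeasure_transmissivityLaw {m n : ℕ} (hn : 1 ≤ n)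
    (τ : Matrix (Fin m) (Fin n) ℂ) : IsProbabilityMeasure (transmissivityLaw τ) := by
  have := isProbabilityMeasure_uniformSphere hn
  exact Measure.isProbabilityMeasure_map (continuous_transmissivity τ).measurable.aemeasurable

end

/-!
In an eigenbasis of `T = τ† τ` with eigenvalues `λᵢ`, the transmissivity of a unit vector `a` is
`∑ λᵢ |aᵢ|²`. The map `z ↦ π |z|²` takes area on `ℂ` to length on the half-line, so for a vector
`z` distributed uniformly in the unit ball the variables `π |zᵢ|²` are jointly uniform on a
simplex (`exists_transmissivityLaw_apply_eq`), and `t` is the ratio of `∑ λᵢ xᵢ` to `∑ xᵢ`.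

The joint law of these two sums under Lebesgue measure on the orthant is analysed by adding one
coordinate at a time. If the eigenvalues are not all equal, two of them give a density in the
plane which is constant on a cone; each further coordinate replaces the density by its integral
along a ray. This preserves homogeneity, which turns the joint density into a density of the
ratio, and logarithmic concavity, by the one-dimensional Prékopa–Leindler inequality
(`prekopa_leindler`). The result is `exists_isConeDensity`. Restricted to height one, the density
is bounded, quasi-concave and of bounded support; after a change at a single point it is unimodal
(`IsConeDensity.exists_isUnimodal`).

The tail bounds hold for every unimodal law. For a law with mode `M`, coefficients `A` and `B` are
found for which `A y² - B - 1_{y > 1}` has nonnegative integral over every interval containing `M`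
(`exists_tailTestPrimitive_le`). Superlevel sets of the density are such intervals, so the
expectation of the test function is nonnegative, and `P(Y > 1) ≤ 4/9 E[Y²]` follows as soon as
`E[Y²] ≤ 3/8` (`IsDensityOf.measureReal_tail_le`). Applying this about the point `μ - σ²/d`, which
optimizes the bound, gives the constant `4/9 σ²/(σ² + d²)` when `3 d² ≥ 5 σ²`; a negative `d`
covers the lower tail. When `T` is scalar the transmissivity is constant.
-/

noncomputable section

open scoped ENNReal

/-! ### The one-dimensional Prékopa–Leindler inequality -/

/-- The one-dimensional Brunn–Minkowski inequality for compact sets: translated so that the last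
point of one set is the first point of the other, the two summands sit side by side. -/
theorem volume_add_le_of_isCompact {K K' C : Set ℝ} (hK : IsCompact K) (hK' : IsCompact K')
    (hne : K.Nonempty) (hne' : K'.Nonempty) {θ : ℝ} (h0 : 0 < θ) (h1 : θ < 1)
    (h : ∀ x ∈ K, ∀ y ∈ K', (1 - θ) * x + θ * y ∈ C) :
    ENNReal.ofReal (1 - θ) * volume K + ENNReal.ofReal θ * volume K' ≤ volume C := by
  obtain ⟨p, hp, hpmax⟩ := hK.exists_isGreatest hne
  obtain ⟨q, hq, hqmin⟩ := hK'.exists_isLeast hne'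
  have himg : ∀ {c : ℝ}, 0 < c → ∀ (d : ℝ) {S : Set ℝ},
      volume ((fun x => c * x + d) '' S) = ENNReal.ofReal c * volume S := by
    intro c hc d S
    have : (fun x => c * x + d) '' S = (fun y => y + d) '' ((fun x => c • x) '' S) := by
      rw [image_image]; simp
    rw [this, image_add_right, measure_preimage_add_right, image_smul,
      Measure.addHaar_smul]
    simp [abs_of_pos hc]
  set A := (fun x => (1 - θ) * x + θ * q) '' K with hA
  set B := (fun y => θ * y + (1 - θ) * p) '' K' with hB
  have hvA : volume A = ENNReal.ofReal (1 - θ) * volume K := himg (by linarith) _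
  have hvB : volume B = ENNReal.ofReal θ * volume K' := himg h0 _
  have hAC : A ∪ B ⊆ C := by
    rintro _ (⟨x, hx, rfl⟩ | ⟨y, hy, rfl⟩)
    · exact h x hx q hq
    · have := h p hp y hy
      simpa [add_comm] using this
  have hmB : MeasurableSet B := (hK'.image (by fun_prop)).measurableSet
  have hdisj : AEDisjoint volume A B := by
    refine measure_mono_null (t := {(1 - θ) * p + θ * q}) ?_ (by simp)
    rintro _ ⟨⟨x, hx, rfl⟩, ⟨y, hy, hxy⟩⟩
    have h2 := hpmax hx
    have h3 := hqmin hy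
    simp only [mem_singleton_iff] at *
    nlinarith
  rw [← hvA, ← hvB, ← measure_union₀ hmB.nullMeasurableSet hdisj]
  exact measure_mono hAC

/-- The one-dimensional Brunn–Minkowski inequality. -/
theorem volume_add_le_of_measurableSet {A B C : Set ℝ} (hA : MeasurableSet A)
    (hB : MeasurableSet B) (hne : A.Nonempty) (hne' : B.Nonempty) {θ : ℝ} (h0 : 0 < θ)
    (h1 : θ < 1) (h : ∀ x ∈ A, ∀ y ∈ B, (1 - θ) * x + θ * y ∈ C) :
    ENNReal.ofReal (1 - θ) * volume A + ENNReal.ofReal θ * volume B ≤ volume C := by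
  obtain ⟨a, ha⟩ := hne
  obtain ⟨b, hb⟩ := hne'
  rw [hA.measure_eq_iSup_isCompact, hB.measure_eq_iSup_isCompact]
  simp only [ENNReal.mul_iSup, iSup_and']
  refine ENNReal.biSup_add_biSup_le' ⟨∅, by simp⟩ ⟨∅, by simp⟩ fun K hK K' hK' => ?_
  have hsub : insert a K ⊆ A := insert_subset ha hK.1
  have hsub' : insert b K' ⊆ B := insert_subset hb hK'.1
  refine le_trans ?_ (volume_add_le_of_isCompact (hK.2.insert a) (hK'.2.insert b)
    (insert_nonempty _ _) (insert_nonempty _ _) h0 h1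
    fun x hx y hy => h x (hsub hx) y (hsub' hy))
  gcongr <;> exact subset_insert _ _

/-- The Prékopa–Leindler inequality for functions whose suprema are both `1`, in its additive
form. -/
theorem lintegral_add_le_of_min_le {f g h : ℝ → ℝ} (hf : Measurable f) (hg : Measurable g)
    (hh : Measurable h) (hf0 : ∀ x, 0 ≤ f x) (hg0 : ∀ x, 0 ≤ g x) (hh0 : ∀ x, 0 ≤ h x)
    (hf1 : ∀ x, f x ≤ 1) (hg1 : ∀ x, g x ≤ 1) (hfs : ∀ y, 0 ≤ y → y < 1 → ∃ x, y < f x)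
    (hgs : ∀ y, 0 ≤ y → y < 1 → ∃ x, y < g x) {θ : ℝ} (h0 : 0 < θ) (h1 : θ < 1)
    (H : ∀ x y, min (f x) (g y) ≤ h ((1 - θ) * x + θ * y)) :
    ENNReal.ofReal (1 - θ) * (∫⁻ x, ENNReal.ofReal (f x)) +
      ENNReal.ofReal θ * (∫⁻ x, ENNReal.ofReal (g x)) ≤ ∫⁻ x, ENNReal.ofReal (h x) := by
  have key : ∀ {u : ℝ → ℝ}, Measurable u → (∀ x, 0 ≤ u x) → 
      ∫⁻ x, ENNReal.ofReal (u x) = ∫⁻ t in Ioi (0 : ℝ), volume {x | t < u x} := fun hu hu0 =>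
    lintegral_eq_lintegral_meas_lt _ (Filter.Eventually.of_forall hu0) hu.aemeasurable
  have hmeas : ∀ u : ℝ → ℝ, Measurable fun t : ℝ => volume {x | t < u x} := fun u =>
    Antitone.measurable fun s t hst => measure_mono fun x hx => lt_of_le_of_lt hst hx
  rw [key hf hf0, key hg hg0, key hh hh0, ← lintegral_const_mul _ (hmeas f),
    ← lintegral_const_mul _ (hmeas g), ← lintegral_add_left ((hmeas f).const_mul _)]
  refine setLIntegral_mono' measurableSet_Ioi fun t ht0 => ?_
  rcases lt_or_ge t 1 with ht | ht
  · refine volume_add_le_of_measurableSet (measurableSet_lt measurable_const hf)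
      (measurableSet_lt measurable_const hg) (hfs t ht0.le ht) (hgs t ht0.le ht) h0 h1
      fun x hx y hy => ?_
    exact lt_of_lt_of_le (lt_min hx hy) (H x y)
  · have e1 : {x | t < f x} = ∅ := by ext x; simpa using (hf1 x).trans ht
    have e2 : {x | t < g x} = ∅ := by ext x; simpa using (hg1 x).trans ht
    simp [e1, e2]

theorem geom_mean_le_arith_mean_ennreal {θ : ℝ} (h0 : 0 < θ) (h1 : θ < 1) (a b : ℝ≥0∞) :
    a ^ (1 - θ) * b ^ θ ≤ ENNReal.ofReal (1 - θ) * a + ENNReal.ofReal θ * b := by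
  have h1' : 0 < 1 - θ := by linarith
  rcases eq_or_ne a ∞ with rfl | ha
  · simp [ENNReal.mul_top, h1]
  rcases eq_or_ne b ∞ with rfl | hb
  · simp [ENNReal.mul_top, h0]
  lift a to NNReal using ha
  lift b to NNReal using hb
  have := NNReal.geom_mean_le_arith_mean2_weighted (Real.toNNReal (1 - θ)) (Real.toNNReal θ) a b
    (by rw [← Real.toNNReal_add h1'.le h0.le]; simp)
  rw [Real.coe_toNNReal _ h1'.le, Real.coe_toNNReal _ h0.le] at this
  rw [← ENNReal.coe_rpow_of_nonneg _ h1'.le, ← ENNReal.coe_rpow_of_nonneg _ h0.le]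
  simp only [ENNReal.ofReal]
  exact_mod_cast this

/-- The one-dimensional Prékopa–Leindler inequality for bounded functions. -/
theorem prekopa_leindler {f g h : ℝ → ℝ≥0∞} (hf : Measurable f) (hg : Measurable g)
    (hh : Measurable h) {C : ℝ≥0∞} (hC : C ≠ ∞) (hfC : ∀ x, f x ≤ C) (hgC : ∀ x, g x ≤ C)
    {θ : ℝ} (h0 : 0 < θ) (h1 : θ < 1)
    (H : ∀ x y, f x ^ (1 - θ) * g y ^ θ ≤ h ((1 - θ) * x + θ * y)) :
    (∫⁻ x, f x) ^ (1 - θ) * (∫⁻ x, g x) ^ θ ≤ ∫⁻ x, h x := by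
  have h1' : 0 < 1 - θ := by linarith
  set F := ⨆ x, f x with hF
  set G := ⨆ x, g x with hG
  have hFf : ∀ x, f x ≤ F := le_iSup f
  have hGg : ∀ x, g x ≤ G := le_iSup g
  have hFC : F ≠ ∞ := ne_top_of_le_ne_top hC (iSup_le hfC)
  have hGC : G ≠ ∞ := ne_top_of_le_ne_top hC (iSup_le hgC)
  rcases eq_or_ne F 0 with hF0 | hF0
  · have : ∀ x, f x = 0 := fun x => le_antisymm ((hFf x).trans hF0.le) zero_le
    simp [this, ENNReal.zero_rpow_of_pos h1']
  rcases eq_or_ne G 0 with hG0 | hG0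
  · have : ∀ x, g x = 0 := fun x => le_antisymm ((hGg x).trans hG0.le) zero_le
    simp [this, ENNReal.zero_rpow_of_pos h0]
  set c := F ^ (1 - θ) * G ^ θ with hc
  have hc0 : c ≠ 0 := by
    simp [hc, ENNReal.rpow_eq_zero_iff, hF0, hG0, hFC, hGC]
  have hcT : c ≠ ∞ := ENNReal.mul_ne_top (ENNReal.rpow_ne_top_of_nonneg h1'.le hFC)
    (ENNReal.rpow_ne_top_of_nonneg h0.le hGC)
  -- Dividing by the suprema reduces to the additive form; `h` is cut off at `1`, where the
  -- level sets of `f` and `g` end, so that it stays finite.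
  have hfr : ∀ x, f x / F ≤ 1 := fun x => ENNReal.div_le_of_le_mul (by simpa using hFf x)
  have hgr : ∀ x, g x / G ≤ 1 := fun x => ENNReal.div_le_of_le_mul (by simpa using hGg x)
  have hhr : ∀ x, min (h x / c) 1 ≠ ∞ := fun x =>
    ne_top_of_le_ne_top ENNReal.one_ne_top (min_le_right _ _)
  have hsup : ∀ {u : ℝ → ℝ≥0∞} {U : ℝ≥0∞}, U = ⨆ x, u x → U ≠ 0 → U ≠ ∞ → (∀ x, u x / U ≤ 1) →
      ∀ y, 0 ≤ y → y < 1 → ∃ x, y < (u x / U).toReal := by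
    intro u U hU hU0 hUT hu y hy0 hy
    have h2 : ENNReal.ofReal y * U < U := by
      have : ENNReal.ofReal y < 1 := by simpa using hy
      simpa using ENNReal.mul_lt_mul_left hU0 hUT this
    rw [hU] at h2
    obtain ⟨x, hx⟩ := lt_iSup_iff.1 h2
    rw [← hU] at hx
    refine ⟨x, (ENNReal.ofReal_lt_iff_lt_toReal hy0
      (ne_top_of_le_ne_top ENNReal.one_ne_top (hu x))).1 ?_⟩
    rwa [ENNReal.lt_div_iff_mul_lt (Or.inl hU0) (Or.inl hUT)]
  have key := lintegral_add_le_of_min_le (f := fun x => (f x / F).toReal)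
    (g := fun x => (g x / G).toReal) (h := fun x => (min (h x / c) 1).toReal)
    (hf.div_const F).ennreal_toReal (hg.div_const G).ennreal_toReal
    ((hh.div_const c).min measurable_const).ennreal_toReal
    (fun _ => ENNReal.toReal_nonneg) (fun _ => ENNReal.toReal_nonneg)
    (fun _ => ENNReal.toReal_nonneg)
    (fun x => ENNReal.toReal_le_of_le_ofReal zero_le_one (by simpa using hfr x))
    (fun x => ENNReal.toReal_le_of_le_ofReal zero_le_one (by simpa using hgr x))
    (hsup hF hF0 hFC hfr) (hsup hG hG0 hGC hgr) h0 h1 ?_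
  · have e1 : ∀ x, ENNReal.ofReal (f x / F).toReal = f x / F := fun x =>
      ENNReal.ofReal_toReal (ne_top_of_le_ne_top ENNReal.one_ne_top (hfr x))
    have e2 : ∀ x, ENNReal.ofReal (g x / G).toReal = g x / G := fun x =>
      ENNReal.ofReal_toReal (ne_top_of_le_ne_top ENNReal.one_ne_top (hgr x))
    have e3 : ∀ x, ENNReal.ofReal (min (h x / c) 1).toReal ≤ h x / c := fun x => by
      rw [ENNReal.ofReal_toReal (hhr x)]; exact min_le_left _ _
    simp only [e1, e2] at key
    replace key := key.trans (lintegral_mono e3)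
    simp only [div_eq_mul_inv] at key
    rw [lintegral_mul_const _ hf, lintegral_mul_const _ hg, lintegral_mul_const _ hh] at key
    have hAG := (geom_mean_le_arith_mean_ennreal h0 h1 ((∫⁻ x, f x) * F⁻¹)
      ((∫⁻ x, g x) * G⁻¹)).trans key
    rw [ENNReal.mul_rpow_of_nonneg _ _ h1'.le, ENNReal.mul_rpow_of_nonneg _ _ h0.le,
      mul_mul_mul_comm, ENNReal.inv_rpow, ENNReal.inv_rpow, ← ENNReal.mul_inv
        (Or.inr (ENNReal.rpow_ne_top_of_nonneg h0.le hGC))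
        (Or.inl (ENNReal.rpow_ne_top_of_nonneg h1'.le hFC)), ← hc] at hAG
    exact (ENNReal.mul_le_mul_iff_left (ENNReal.inv_ne_zero.2 hcT)
      (ENNReal.inv_ne_top.2 hc0)).1 hAG
  · intro x y
    rw [← ENNReal.toReal_min (ne_top_of_le_ne_top ENNReal.one_ne_top (hfr x))
      (ne_top_of_le_ne_top ENNReal.one_ne_top (hgr y))]
    refine ENNReal.toReal_mono (hhr _) (le_min ?_ ((min_le_left _ _).trans (hfr x)))
    set m := min (f x / F) (g y / G)
    have hm1 : m ≤ f x / F := min_le_left _ _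
    have hm2 : m ≤ g y / G := min_le_right _ _
    calc m = m ^ (1 - θ) * m ^ θ := by
          rw [← ENNReal.rpow_add_of_nonneg _ _ h1'.le h0.le]; simp
      _ ≤ (f x / F) ^ (1 - θ) * (g y / G) ^ θ := by gcongr
      _ = f x ^ (1 - θ) * g y ^ θ / c := by
          rw [ENNReal.div_rpow_of_nonneg _ _ h1'.le, ENNReal.div_rpow_of_nonneg _ _ h0.le,
            div_eq_mul_inv, div_eq_mul_inv, div_eq_mul_inv, mul_mul_mul_comm,
            ← ENNReal.mul_inv (Or.inr (ENNReal.rpow_ne_top_of_nonneg h0.le hGC))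
              (Or.inl (ENNReal.rpow_ne_top_of_nonneg h1'.le hFC))]
      _ ≤ h ((1 - θ) * x + θ * y) / c := by gcongr; exact H x y

/-! ### Linear images of Lebesgue measure on an orthant -/

theorem lintegral_comp_mul_left_pos {f : ℝ → ℝ≥0∞} (hf : Measurable f) {c : ℝ} (hc : 0 < c) :
    ∫⁻ x, f x = ENNReal.ofReal c * ∫⁻ x, f (c * x) := by
  have h := Measure.map_addHaar_smul (volume : Measure ℝ) hc.ne'
  have h2 : ∫⁻ x, f (c * x) = ∫⁻ x, f x ∂(Measure.map (c • ·) volume) := by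
    rw [lintegral_map hf (measurable_const_smul c)]; simp
  rw [h2, h, lintegral_smul_measure, smul_eq_mul, ← mul_assoc, ← ENNReal.ofReal_mul hc.le]
  simp [abs_of_pos hc, hc.ne']

/-- The properties of the density of the image of Lebesgue measure on an orthant under a linear
map to the plane: it is logarithmically concave, homogeneous of degree `k`, bounded by a multiple of
the `k`-th power of the second coordinate, and supported in a cone around the positive second
coordinate axis. At weights `0 < θ < 1`, logarithmic concavity includes the convention that the
weighted geometric mean vanishes with either factor. -/
structure IsConeDensity (k : ℕ) (h : ℝ × ℝ → ℝ≥0∞) : Prop where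
  measurable : Measurable h
  log_concave : ∀ θ : ℝ, 0 < θ → θ < 1 → ∀ w w' : ℝ × ℝ,
    h w ^ (1 - θ) * h w' ^ θ ≤ h ((1 - θ) • w + θ • w')
  homogeneous : ∀ c : ℝ, 0 < c → ∀ w, h (c • w) = ENNReal.ofReal c ^ k * h w
  bounded : ∃ C : ℝ≥0∞, C ≠ ∞ ∧ ∀ w, h w ≤ C * ENNReal.ofReal w.2 ^ k
  support : ∃ L : ℝ, ∀ w, h w ≠ 0 → 0 ≤ w.2 ∧ |w.1| ≤ L * w.2

/-- The integral of a function over the half-lines in direction `-v`: the density of the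
convolution with the image of Lebesgue measure on the half-line through `v`. -/
def rayIntegral (h : ℝ × ℝ → ℝ≥0∞) (v : ℝ × ℝ) (w : ℝ × ℝ) : ℝ≥0∞ :=
  ∫⁻ u in Ioi (0 : ℝ), h (w - u • v)

theorem measurable_uncurry_ray {h : ℝ × ℝ → ℝ≥0∞} (hh : Measurable h) (v : ℝ × ℝ) :
    Measurable fun p : (ℝ × ℝ) × ℝ => h (p.1 - p.2 • v) :=
  hh.comp (measurable_fst.sub (measurable_snd.smul_const v))

theorem measurable_ray {h : ℝ × ℝ → ℝ≥0∞} (hh : Measurable h) (v w : ℝ × ℝ) :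
    Measurable fun u : ℝ => h (w - u • v) :=
  hh.comp (measurable_const.sub (measurable_id.smul_const v))

theorem measurable_rayIntegral {h : ℝ × ℝ → ℝ≥0∞} (hh : Measurable h) (v : ℝ × ℝ) :
    Measurable (rayIntegral h v) :=
  (measurable_uncurry_ray hh v).lintegral_prod_right'

theorem rayIntegral_eq_lintegral_indicator (h : ℝ × ℝ → ℝ≥0∞) (v w : ℝ × ℝ) :
    rayIntegral h v w = ∫⁻ u, (Ioi (0 : ℝ)).indicator (fun u => h (w - u • v)) u := by
  rw [rayIntegral, lintegral_indicator measurableSet_Ioi]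

theorem IsConeDensity.rayIntegral {k : ℕ} {h : ℝ × ℝ → ℝ≥0∞} (hh : IsConeDensity k h) (l : ℝ) :
    IsConeDensity (k + 1) (rayIntegral h (l, 1)) := by
  obtain ⟨C, hC, hhC⟩ := hh.bounded
  obtain ⟨L, hL⟩ := hh.support
  have hpos : ∀ (w : ℝ × ℝ) (u : ℝ), 0 < u → h (w - u • (l, 1)) ≤ C * ENNReal.ofReal w.2 ^ k := by
    intro w u hu
    refine (hhC _).trans ?_
    gcongr
    simp [hu.le]
  refine ⟨measurable_rayIntegral hh.measurable _, ?_, ?_, ⟨C, hC, ?_⟩, ⟨|L| + |l|, ?_⟩⟩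
  · intro θ h0 h1 w w'
    have h1' : 0 < 1 - θ := by linarith
    simp only [rayIntegral_eq_lintegral_indicator]
    have hm := fun w => (measurable_ray hh.measurable (l, 1) w).indicator
      (measurableSet_Ioi (a := (0 : ℝ)))
    have hbd : ∀ w u, (Ioi (0 : ℝ)).indicator (fun u => h (w - u • (l, (1 : ℝ)))) u ≤
        C * ENNReal.ofReal w.2 ^ k := by
      intro w u
      by_cases hu : 0 < u
      · simpa [hu] using hpos w u hu
      · simp [hu]
    refine prekopa_leindler (hm w) (hm w') (hm _)
      (C := C * ENNReal.ofReal w.2 ^ k + C * ENNReal.ofReal w'.2 ^ k) ?_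
      (fun x => (hbd w x).trans le_self_add) (fun x => (hbd w' x).trans le_add_self) h0 h1 ?_
    · simp [ENNReal.mul_eq_top, hC]
    · intro x y
      by_cases hx : 0 < x
      · by_cases hy : 0 < y
        · have hxy : 0 < (1 - θ) * x + θ * y := by positivity
          simp only [indicator, mem_Ioi, hx, hy, hxy, if_true]
          convert hh.log_concave θ h0 h1 (w - x • (l, (1 : ℝ))) (w' - y • (l, (1 : ℝ))) using 2
          module
        · simp [hy, ENNReal.zero_rpow_of_pos h0]
      · simp [hx, ENNReal.zero_rpow_of_pos h1']
  · intro c hc w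
    rw [rayIntegral_eq_lintegral_indicator, lintegral_comp_mul_left_pos
      ((measurable_ray hh.measurable (l, 1) _).indicator measurableSet_Ioi) hc,
      rayIntegral_eq_lintegral_indicator, pow_succ, mul_comm _ (ENNReal.ofReal c), mul_assoc,
      ← lintegral_const_mul _ ((measurable_ray hh.measurable (l, 1) _).indicator
        measurableSet_Ioi)]
    congr 2
    funext u
    by_cases hu : 0 < u
    · simp only [indicator, mem_Ioi, hu, mul_pos hc hu, if_true]
      rw [← hh.homogeneous c hc, smul_sub, smul_smul]
    · have : ¬ 0 < c * u := by
        simpa [mul_pos_iff_of_pos_left hc] using hu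
      simp [hu, this]
  · intro w
    rw [_root_.rayIntegral]
    calc ∫⁻ u in Ioi (0 : ℝ), h (w - u • (l, 1))
        ≤ ∫⁻ u in Ioi (0 : ℝ), (Iic w.2).indicator (fun _ => C * ENNReal.ofReal w.2 ^ k) u := by
          refine setLIntegral_mono' measurableSet_Ioi fun u hu => ?_
          by_cases hu2 : u ≤ w.2
          · simpa [hu2] using hpos w u hu
          · have : h (w - u • (l, 1)) = 0 := by
              by_contra hne
              have := (hL _ hne).1
              simp at this
              exact hu2 this
            rw [this]
            exact zero_le
      _ = C * ENNReal.ofReal w.2 ^ (k + 1) := by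
          rw [lintegral_indicator measurableSet_Iic, lintegral_const,
            Measure.restrict_restrict measurableSet_Iic, Measure.restrict_apply_univ,
            Iic_inter_Ioi, Real.volume_Ioc, sub_zero, pow_succ, mul_assoc]
  · intro w hw
    have : ∃ u : ℝ, 0 < u ∧ h (w - u • (l, 1)) ≠ 0 := by
      by_contra! hcon
      exact hw ((setLIntegral_congr_fun measurableSet_Ioi hcon).trans (by simp))
    obtain ⟨u, hu, hne⟩ := this
    obtain ⟨h2, h3⟩ := hL _ hne
    simp only [Prod.fst_sub, Prod.snd_sub, Prod.smul_fst, Prod.smul_snd, smul_eq_mul, mul_one]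
      at h2 h3
    have hw2 : 0 ≤ w.2 := by linarith
    refine ⟨hw2, ?_⟩
    calc |w.1| = |(w.1 - u * l) + u * l| := by ring_nf
      _ ≤ |w.1 - u * l| + |u * l| := abs_add_le _ _
      _ ≤ |L| * (w.2 - u) + u * |l| := by
          rw [abs_mul, abs_of_pos hu]
          gcongr
          exact h3.trans (mul_le_mul_of_nonneg_right (le_abs_self L) h2)
      _ ≤ |L| * w.2 + w.2 * |l| := by
          gcongr <;> linarith
      _ = (|L| + |l|) * w.2 := by ring

/-- The image of Lebesgue measure on the positive orthant under `x ↦ (∑ lᵢ xᵢ, ∑ xᵢ)`. -/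
def orthantImage {n : ℕ} (l : Fin n → ℝ) : Measure (ℝ × ℝ) :=
  (Measure.pi fun _ : Fin n => (volume : Measure ℝ).restrict (Ioi 0)).map
    fun x => (∑ i, l i * x i, ∑ i, x i)

/-- Adding a coordinate to the orthant integrates the density along a ray. -/
theorem orthantImage_eq_withDensity_rayIntegral {n : ℕ} {l : Fin (n + 1) → ℝ} (i : Fin (n + 1))
    {h : ℝ × ℝ → ℝ≥0∞} (hh : Measurable h)
    (hl : orthantImage (fun j => l (i.succAbove j)) = volume.withDensity h) :
    orthantImage l = volume.withDensity (rayIntegral h (l i, 1)) := by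
  set ρ : Measure ℝ := (volume : Measure ℝ).restrict (Ioi 0) with hρ
  have hmp := measurePreserving_piFinSuccAbove (fun _ : Fin (n + 1) => ρ) i
  set Φ : (Fin n → ℝ) → ℝ × ℝ := fun x => (∑ j, l (i.succAbove j) * x j, ∑ j, x j) with hΦ
  have hΦm : Measurable Φ := by fun_prop
  set Ψ : ℝ × (Fin n → ℝ) → ℝ × ℝ := fun p => p.1 • (l i, (1 : ℝ)) + Φ p.2 with hΨ
  have hΨm : Measurable Ψ := by fun_prop
  have hcomp : (fun x : Fin (n + 1) → ℝ => (∑ j, l j * x j, ∑ j, x j)) =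
      Ψ ∘ MeasurableEquiv.piFinSuccAbove (fun _ => ℝ) i := by
    funext x
    simp [hΨ, hΦ, Fin.sum_univ_succAbove _ i, mul_comm]
    rfl
  rw [orthantImage, hcomp, ← Measure.map_map hΨm (MeasurableEquiv.measurable _), hmp.map_eq]
  ext s hs
  rw [Measure.map_apply hΨm hs, Measure.prod_apply (hΨm hs), withDensity_apply _ hs]
  have h1 : ∀ u : ℝ, (Measure.pi fun _ : Fin n => ρ) (Prod.mk u ⁻¹' (Ψ ⁻¹' s)) =
      ∫⁻ w, s.indicator (fun w => h (w - u • (l i, (1 : ℝ)))) w := by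
    intro u
    have hs' : MeasurableSet ((fun w : ℝ × ℝ => u • (l i, (1 : ℝ)) + w) ⁻¹' s) :=
      (measurable_const_add _) hs
    have : Prod.mk u ⁻¹' (Ψ ⁻¹' s) = Φ ⁻¹' ((fun w : ℝ × ℝ => u • (l i, (1 : ℝ)) + w) ⁻¹' s) := rfl
    rw [this, ← Measure.map_apply hΦm hs']
    change orthantImage (fun j => l (i.succAbove j)) _ = _
    rw [hl, withDensity_apply _ hs', ← lintegral_indicator hs',
      ← lintegral_add_left_eq_self (s.indicator fun w => h (w - u • (l i, (1 : ℝ))))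
        (u • (l i, (1 : ℝ)))]
    congr 1
    funext w
    by_cases hw : u • (l i, (1 : ℝ)) + w ∈ s
    · rw [indicator_of_mem hw, indicator_of_mem (by exact hw), add_sub_cancel_left]
    · rw [indicator_of_notMem hw, indicator_of_notMem (by exact hw)]
  simp only [h1]
  rw [lintegral_lintegral_swap]
  · rw [← lintegral_indicator hs]
    congr 1
    funext w
    by_cases hw : w ∈ s
    · simp [hw, rayIntegral, hρ]
    · simp [hw]
  · refine Measurable.aemeasurable ?_
    have : (Function.uncurry fun (u : ℝ) (w : ℝ × ℝ) =>
        s.indicator (fun w => h (w - u • (l i, (1 : ℝ)))) w) =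
        (Prod.snd ⁻¹' s).indicator fun p : ℝ × (ℝ × ℝ) => h (p.2 - p.1 • (l i, (1 : ℝ))) := by
      funext p
      by_cases hp : p.2 ∈ s <;> simp [Function.uncurry, hp]
    rw [this]
    exact (hh.comp (measurable_snd.sub (measurable_fst.smul_const _))).indicator
      (measurable_snd hs)

/-- Two distinct coefficients make the map `x ↦ (l₀ x₀ + l₁ x₁, x₀ + x₁)` invertible, and the
density is constant on the image of the quadrant. -/
theorem exists_isConeDensity_two {l : Fin 2 → ℝ} (hl : l 0 ≠ l 1) :
    ∃ h, IsConeDensity 0 h ∧ orthantImage l = volume.withDensity h := by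
  have hd : l 0 - l 1 ≠ 0 := sub_ne_zero.2 hl
  let e : (ℝ × ℝ) ≃ₗ[ℝ] (ℝ × ℝ) :=
    { toFun := fun p => (l 0 * p.1 + l 1 * p.2, p.1 + p.2)
      map_add' := fun p q => by ext <;> simp <;> ring
      map_smul' := fun c p => by ext <;> simp <;> ring
      invFun := fun w => ((w.1 - l 1 * w.2) / (l 0 - l 1), (l 0 * w.2 - w.1) / (l 0 - l 1))
      left_inv := fun p => by ext <;> simp <;> field_simp <;> ring
      right_inv := fun w => by ext <;> simp <;> field_simp <;> ring }
  have he : Measurable e := by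
    change Measurable fun p : ℝ × ℝ => (l 0 * p.1 + l 1 * p.2, p.1 + p.2)
    fun_prop
  have he' : Measurable e.symm := by
    change Measurable fun w : ℝ × ℝ =>
      ((w.1 - l 1 * w.2) / (l 0 - l 1), (l 0 * w.2 - w.1) / (l 0 - l 1))
    fun_prop
  set S : Set (ℝ × ℝ) := Ioi 0 ×ˢ Ioi 0 with hS
  have hSm : MeasurableSet S := measurableSet_Ioi.prod measurableSet_Ioi
  set T : Set (ℝ × ℝ) := e.symm ⁻¹' S with hT
  have hTm : MeasurableSet T := he' hSm
  set κ : ℝ≥0∞ := ENNReal.ofReal |LinearMap.det (e.symm : ℝ × ℝ →ₗ[ℝ] ℝ × ℝ)| with hκ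
  refine ⟨T.indicator fun _ => κ, ⟨measurable_const.indicator hTm, ?_, ?_, ⟨κ, by simp [hκ], ?_⟩,
    ⟨|l 0| + |l 1|, ?_⟩⟩, ?_⟩
  · intro θ h0 h1 w w'
    have h1' : 0 < 1 - θ := by linarith
    by_cases hw : w ∈ T
    · by_cases hw' : w' ∈ T
      · have : (1 - θ) • w + θ • w' ∈ T := by
          simp only [hT, hS, mem_preimage, map_add, map_smul, mem_prod, mem_Ioi, Prod.fst_add,
            Prod.snd_add, Prod.smul_fst, Prod.smul_snd, smul_eq_mul] at hw hw' ⊢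
          obtain ⟨h2, h3⟩ := hw
          obtain ⟨h4, h5⟩ := hw'
          constructor <;> positivity
        rw [indicator_of_mem hw, indicator_of_mem hw', indicator_of_mem this,
          ← ENNReal.rpow_add_of_nonneg _ _ h1'.le h0.le]
        simp
      · simp [hw', ENNReal.zero_rpow_of_pos h0]
    · simp [hw, ENNReal.zero_rpow_of_pos h1']
  · intro c hc w
    have : c • w ∈ T ↔ w ∈ T := by
      simp [hT, hS, mul_pos_iff_of_pos_left hc]
    by_cases hw : w ∈ T
    · rw [indicator_of_mem hw, indicator_of_mem (this.2 hw)]; simp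
    · rw [indicator_of_notMem hw, indicator_of_notMem (mt this.1 hw)]; simp
  · intro w
    by_cases hw : w ∈ T <;> simp [hw]
  · intro w hw
    have hw : w ∈ T := mem_of_indicator_ne_zero hw
    obtain ⟨h2, h3⟩ := hw
    rw [mem_Ioi] at h2 h3
    obtain ⟨p, rfl⟩ := e.surjective w
    rw [e.symm_apply_apply] at h2 h3
    change 0 ≤ p.1 + p.2 ∧ |l 0 * p.1 + l 1 * p.2| ≤ (|l 0| + |l 1|) * (p.1 + p.2)
    refine ⟨by positivity, (abs_add_le _ _).trans ?_⟩
    rw [abs_mul, abs_mul, abs_of_pos h2, abs_of_pos h3]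
    nlinarith [mul_nonneg (abs_nonneg (l 0)) h3.le, mul_nonneg (abs_nonneg (l 1)) h2.le]
  · have hmp := measurePreserving_piFinTwo fun _ : Fin 2 => (volume : Measure ℝ).restrict (Ioi 0)
    have hcomp : (fun x : Fin 2 → ℝ => (∑ j, l j * x j, ∑ j, x j)) =
        e ∘ MeasurableEquiv.piFinTwo (fun _ => ℝ) := by
      funext x
      simp only [Fin.sum_univ_two]
      rfl
    rw [orthantImage, hcomp, ← Measure.map_map he (MeasurableEquiv.measurable _), hmp.map_eq,
      Measure.prod_restrict]
    ext s hs
    rw [Measure.map_apply he hs, Measure.restrict_apply (he hs), withDensity_apply _ hs,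
      lintegral_indicator hTm, lintegral_const, Measure.restrict_restrict hTm,
      Measure.restrict_apply_univ]
    have : e ⁻¹' s ∩ S = e ⁻¹' (T ∩ s) := by
      ext p
      simp [hT, and_comm]
    change volume (e ⁻¹' s ∩ S) = _
    rw [this, Measure.addHaar_preimage_linearEquiv]

/-- If the coefficients are not all equal, the image of Lebesgue measure on the orthant has a
homogeneous, logarithmically concave density. -/
theorem exists_isConeDensity (n : ℕ) (l : Fin (n + 2) → ℝ) (hl : ∃ i j, l i ≠ l j) :
    ∃ h, IsConeDensity n h ∧ orthantImage l = volume.withDensity h := by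
  induction n with
  | zero =>
    refine exists_isConeDensity_two fun h => ?_
    obtain ⟨i, j, hij⟩ := hl
    fin_cases i <;> fin_cases j <;> simp_all
  | succ n ih =>
    obtain ⟨a, b, hab⟩ := hl
    -- The coordinate removed must leave two distinct coefficients behind.
    obtain ⟨i, hia, hib⟩ : ∃ i : Fin (n + 1 + 2), i ≠ a ∧ i ≠ b := by
      have : ({a, b} : Finset (Fin (n + 1 + 2)))ᶜ.Nonempty := by
        rw [← Finset.card_pos, Finset.card_compl, Fintype.card_fin]
        have := Finset.card_le_two (a := a) (b := b)
        omega
      obtain ⟨i, hi⟩ := this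
      simp at hi
      exact ⟨i, hi.1, hi.2⟩
    obtain ⟨a', ha'⟩ := Fin.exists_succAbove_eq hia.symm
    obtain ⟨b', hb'⟩ := Fin.exists_succAbove_eq hib.symm
    obtain ⟨h, hh, hl'⟩ := ih (fun j => l (i.succAbove j)) ⟨a', b', by rwa [ha', hb']⟩
    exact ⟨_, hh.rayIntegral (l i), orthantImage_eq_withDensity_rayIntegral i hh.measurable hl'⟩

/-! ### From the complex sphere to the orthant -/

section Sphere

variable {m n : ℕ}

/-- The area of the disc of radius `r` is `π r²`, so `z ↦ π |z|²` maps area to Lebesgue measure on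
the positive half-line. -/
theorem measurePreserving_pi_mul_norm_sq :
    MeasurePreserving (fun z : ℂ => Real.pi * ‖z‖ ^ 2) volume
      ((volume : Measure ℝ).restrict (Ioi 0)) := by
  have hm : Measurable fun z : ℂ => Real.pi * ‖z‖ ^ 2 := by fun_prop
  have hball : ∀ b : ℝ, volume {z : ℂ | Real.pi * ‖z‖ ^ 2 ≤ b} = ENNReal.ofReal b := by
    intro b
    rcases lt_or_ge b 0 with hb | hb
    · have : {z : ℂ | Real.pi * ‖z‖ ^ 2 ≤ b} = ∅ := by
        ext z
        have : 0 ≤ Real.pi * ‖z‖ ^ 2 := by positivity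
        simp only [mem_ofPred_eq, mem_empty_iff_false, iff_false, not_le]
        linarith
      rw [this, measure_empty, ENNReal.ofReal_of_nonpos hb.le]
    · have : {z : ℂ | Real.pi * ‖z‖ ^ 2 ≤ b} = Metric.closedBall 0 (√(b / Real.pi)) := by
        ext z
        rw [mem_ofPred_eq, mem_closedBall_zero_iff, Real.le_sqrt (norm_nonneg z) (by positivity),
          le_div_iff₀ Real.pi_pos, mul_comm]
      rw [this, Complex.volume_closedBall, ← ENNReal.ofReal_pow (Real.sqrt_nonneg _),
        Real.sq_sqrt (by positivity), ENNReal.ofReal_div_of_pos Real.pi_pos]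
      have : ((NNReal.pi : NNReal) : ℝ≥0∞) = ENNReal.ofReal Real.pi := by
        rw [← NNReal.coe_real_pi, ENNReal.ofReal_coe_nnreal]
      rw [this]
      exact ENNReal.div_mul_cancel (by simp [Real.pi_pos]) ENNReal.ofReal_ne_top
  refine ⟨hm, (Measure.ext_of_Ioc _ _ fun a b hab => ?_).symm⟩
  rw [Measure.map_apply hm measurableSet_Ioc, Measure.restrict_apply measurableSet_Ioc]
  have h1 : (fun z : ℂ => Real.pi * ‖z‖ ^ 2) ⁻¹' Ioc a b =
      {z : ℂ | Real.pi * ‖z‖ ^ 2 ≤ b} \ {z : ℂ | Real.pi * ‖z‖ ^ 2 ≤ a} := by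
    ext z; simp [and_comm]
  have h2 : Ioc a b ∩ Ioi 0 = Ioc (max a 0) b := by
    rw [← Ioc_inter_Ioi]
  have h3 : {z : ℂ | Real.pi * ‖z‖ ^ 2 ≤ a} ⊆ {z : ℂ | Real.pi * ‖z‖ ^ 2 ≤ b} :=
    fun z hz => le_trans hz hab.le
  rw [h1, h2, measure_sdiff h3 (measurableSet_le hm measurable_const).nullMeasurableSet
    (by rw [hball]; simp), hball, hball,
    Real.volume_Ioc]
  rcases le_total a 0 with ha | ha
  · simp [ha, ENNReal.ofReal_of_nonpos ha]
  · rw [max_eq_left ha, ENNReal.ofReal_sub _ ha]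

/-- In an orthonormal eigenbasis of the transmittance matrix, the quadratic form `z† T z` is a
weighted sum of the squared moduli of the coordinates. -/
theorem re_dotProduct_mulVec_eq_sum {T : Matrix (Fin n) (Fin n) ℂ} (hT : T.IsHermitian)
    (z : EuclideanSpace ℂ (Fin n)) :
    (star z.ofLp ⬝ᵥ (T *ᵥ z.ofLp)).re =
      ∑ i, hT.eigenvalues i * ‖hT.eigenvectorBasis.repr z i‖ ^ 2 := by
  have h1 : star z.ofLp ⬝ᵥ (T *ᵥ z.ofLp) = inner ℂ z (WithLp.toLp 2 (T *ᵥ z.ofLp)) := by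
    rw [EuclideanSpace.inner_eq_star_dotProduct, dotProduct_comm]
  have h2 : ∀ i, inner ℂ (hT.eigenvectorBasis i) (WithLp.toLp 2 (T *ᵥ z.ofLp)) =
      hT.eigenvalues i * inner ℂ (hT.eigenvectorBasis i) z := by
    intro i
    have hstar : star (hT.eigenvectorBasis i).ofLp ᵥ* T =
        star (T *ᵥ (hT.eigenvectorBasis i).ofLp) := by
      rw [star_mulVec, hT.eq]
    rw [EuclideanSpace.inner_eq_star_dotProduct, EuclideanSpace.inner_eq_star_dotProduct,
      dotProduct_comm, dotProduct_mulVec, hstar, hT.mulVec_eigenvectorBasis i]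
    simp [dotProduct_comm]
  rw [h1, ← hT.eigenvectorBasis.sum_inner_mul_inner, Complex.re_sum]
  refine Finset.sum_congr rfl fun i _ => ?_
  rw [h2, ← inner_conj_symm, hT.eigenvectorBasis.repr_apply_apply]
  rw [mul_left_comm, ← Complex.normSq_eq_conj_mul_self, Complex.normSq_eq_norm_sq]
  norm_cast

/-- The map sending a vector to the squared moduli of its coordinates in an orthonormal basis turns
Lebesgue measure on `ℂⁿ` into a multiple of Lebesgue measure on the positive orthant. -/
theorem exists_map_norm_sq_repr_eq_smul
    (b : OrthonormalBasis (Fin n) ℂ (EuclideanSpace ℂ (Fin n))) :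
    ∃ c : ℝ≥0∞, c ≠ ∞ ∧
      (volume : Measure (EuclideanSpace ℂ (Fin n))).map
        (fun z i => Real.pi * ‖b.repr z i‖ ^ 2) =
        c • Measure.pi fun _ : Fin n => (volume : Measure ℝ).restrict (Ioi 0) := by
  -- The coordinate map is a linear isomorphism, so it carries Lebesgue measure to a Haar measure.
  let e : EuclideanSpace ℂ (Fin n) ≃L[ℂ] (Fin n → ℂ) :=
    b.repr.toContinuousLinearEquiv.trans (PiLp.continuousLinearEquiv 2 ℂ fun _ : Fin n => ℂ)
  have he : Measure.IsAddHaarMeasure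
      ((volume : Measure (EuclideanSpace ℂ (Fin n))).map e) := e.isAddHaarMeasure_map _
  have hmp := measurePreserving_pi (fun _ : Fin n => (volume : Measure ℂ)) _
    fun _ => measurePreserving_pi_mul_norm_sq
  refine ⟨Measure.addHaarScalarFactor (volume.map e) (volume : Measure (Fin n → ℂ)),
    ENNReal.coe_ne_top, ?_⟩
  have hcomp : (fun (z : EuclideanSpace ℂ (Fin n)) i => Real.pi * ‖b.repr z i‖ ^ 2) =
      (fun (x : Fin n → ℂ) i => Real.pi * ‖x i‖ ^ 2) ∘ e := rfl
  have key := Measure.isAddLeftInvariant_eq_smul (volume.map e) (volume : Measure (Fin n → ℂ))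
  rw [hcomp, ← Measure.map_map hmp.measurable e.continuous.measurable]
  refine (congrArg _ key).trans ?_
  rw [Measure.map_smul]
  exact congrArg _ hmp.map_eq

open scoped Pointwise in
/-- The part of the unit ball lying radially over a preimage of the transmissivity, whose volume
defines the surface measure of that preimage. -/
theorem Ioo_smul_image_transmissivity (τ : Matrix (Fin m) (Fin n) ℂ) (B : Set ℝ) :
    Ioo (0 : ℝ) 1 • (((↑) : ComplexSphere n → EuclideanSpace ℂ (Fin n)) ''
      (transmissivity τ ⁻¹' B)) =
    {z : EuclideanSpace ℂ (Fin n) | 0 < ‖z‖ ∧ ‖z‖ < 1 ∧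
      (star z.ofLp ⬝ᵥ (transmittanceMatrix τ *ᵥ z.ofLp)).re / ‖z‖ ^ 2 ∈ B} := by
  have hscale : ∀ (r : ℝ) (z : EuclideanSpace ℂ (Fin n)),
      (star (r • z).ofLp ⬝ᵥ (transmittanceMatrix τ *ᵥ (r • z).ofLp)).re =
        r ^ 2 * (star z.ofLp ⬝ᵥ (transmittanceMatrix τ *ᵥ z.ofLp)).re := by
    intro r z
    simp only [WithLp.ofLp_smul, mulVec_smul, star_smul, smul_dotProduct, dotProduct_smul,
      star_trivial, Complex.real_smul, Complex.re_ofReal_mul]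
    ring
  ext z
  simp only [mem_smul, mem_image, mem_preimage, mem_ofPred_eq]
  constructor
  · rintro ⟨r, ⟨hr0, hr1⟩, _, ⟨a, ha, rfl⟩, rfl⟩
    have hna : ‖(a : EuclideanSpace ℂ (Fin n))‖ = 1 := norm_eq_of_mem_sphere a
    rw [norm_smul, hna, mul_one, Real.norm_of_nonneg hr0.le, hscale,
      mul_div_cancel_left₀ _ (by positivity)]
    exact ⟨hr0, hr1, ha⟩
  · rintro ⟨h0, h1, hB⟩
    refine ⟨‖z‖, ⟨h0, h1⟩, ‖z‖⁻¹ • z, ⟨⟨‖z‖⁻¹ • z, ?_⟩, ?_, rfl⟩, ?_⟩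
    · simp [norm_smul, h0.ne']
    · rw [transmissivity, hscale]
      convert hB using 1
      field_simp
    · rw [smul_smul, mul_inv_cancel₀ h0.ne', one_smul]

theorem isHermitian_transmittanceMatrix (τ : Matrix (Fin m) (Fin n) ℂ) :
    (transmittanceMatrix τ).IsHermitian :=
  isHermitian_conjTranspose_mul_self τ

/-- The law of the transmissivity is, up to a constant, the image of Lebesgue measure on the
simplex `{x ≥ 0, ∑ xᵢ < π}` under the average `∑ λᵢ xᵢ / ∑ xᵢ` of the eigenvalues. -/
theorem exists_transmissivityLaw_apply_eq (hn : 1 ≤ n) (τ : Matrix (Fin m) (Fin n) ℂ) :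
    ∃ K : ℝ≥0∞, K ≠ ∞ ∧ ∀ B : Set ℝ, MeasurableSet B → transmissivityLaw τ B =
      K * orthantImage (isHermitian_transmittanceMatrix τ).eigenvalues
        {w | 0 < w.2 ∧ w.2 < Real.pi ∧ w.1 / w.2 ∈ B} := by
  set hT := isHermitian_transmittanceMatrix τ
  set b := hT.eigenvectorBasis with hb
  obtain ⟨c, hc, hmap⟩ := exists_map_norm_sq_repr_eq_smul b
  have : Nonempty (Fin n) := ⟨⟨0, hn⟩⟩
  refine ⟨((volume : Measure (EuclideanSpace ℂ (Fin n))).toSphere univ)⁻¹ *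
    (Module.finrank ℝ (EuclideanSpace ℂ (Fin n)) * c), ?_, fun B hB => ?_⟩
  · refine ENNReal.mul_ne_top (ENNReal.inv_ne_top.2 ?_)
      (ENNReal.mul_ne_top (ENNReal.natCast_ne_top _) hc)
    rw [Measure.measure_univ_ne_zero]
    exact Measure.toSphere_ne_zero _
  · have hW : MeasurableSet {w : ℝ × ℝ | 0 < w.2 ∧ w.2 < Real.pi ∧ w.1 / w.2 ∈ B} :=
      (measurableSet_lt measurable_const measurable_snd).inter
        ((measurableSet_lt measurable_snd measurable_const).inter
          ((measurable_fst.div measurable_snd) hB))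
    have hΦ : Measurable fun x : Fin n → ℝ => (∑ i, hT.eigenvalues i * x i, ∑ i, x i) := by
      fun_prop
    have hΘ : Measurable fun (z : EuclideanSpace ℂ (Fin n)) (i : Fin n) =>
        Real.pi * ‖b.repr z i‖ ^ 2 := by
      refine Continuous.measurable ?_
      fun_prop
    rw [transmissivityLaw, Measure.map_apply (continuous_transmissivity τ).measurable hB,
      uniformSphere, Measure.smul_apply, smul_eq_mul,
      Measure.toSphere_apply' _ ((continuous_transmissivity τ).measurable hB),
      Ioo_smul_image_transmissivity, orthantImage, Measure.map_apply hΦ hW, mul_assoc, mul_assoc,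
      ← smul_eq_mul c, ← Measure.smul_apply, ← hmap, Measure.map_apply hΘ (hΦ hW)]
    congr 3
    ext z
    have hpi := Real.pi_pos
    have e1 : ∑ i, Real.pi * ‖b.repr z i‖ ^ 2 = Real.pi * ‖z‖ ^ 2 := by
      rw [← Finset.mul_sum, ← EuclideanSpace.norm_sq_eq, b.repr.norm_map]
    have e2 : ∑ i, hT.eigenvalues i * (Real.pi * ‖b.repr z i‖ ^ 2) =
        Real.pi * (star z.ofLp ⬝ᵥ (transmittanceMatrix τ *ᵥ z.ofLp)).re := by
      rw [re_dotProduct_mulVec_eq_sum hT, Finset.mul_sum]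
      exact Finset.sum_congr rfl fun i _ => by ring
    simp only [mem_ofPred_eq, mem_preimage, e1, e2]
    rw [mul_div_mul_left _ _ hpi.ne', mul_pos_iff_of_pos_left hpi,
      mul_lt_iff_lt_one_right hpi, sq_lt_one_iff₀ (norm_nonneg z)]
    simp only [norm_pos_iff, ne_eq, sq_pos_iff, norm_eq_zero]
 
/-- The measure on the line obtained from a homogeneous density in the plane by taking the ratio of
the coordinates has the restriction of that density to the line at height one as its density. -/
theorem IsConeDensity.withDensity_apply_ratio {k : ℕ} {h : ℝ × ℝ → ℝ≥0∞} (hh : IsConeDensity k h)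
    {B : Set ℝ} (hB : MeasurableSet B) (R : ℝ) :
    volume.withDensity h {w | 0 < w.2 ∧ w.2 < R ∧ w.1 / w.2 ∈ B} =
      (∫⁻ r in Ioo 0 R, ENNReal.ofReal r ^ (k + 1)) * ∫⁻ s in B, h (s, 1) := by
  have hW : MeasurableSet {w : ℝ × ℝ | 0 < w.2 ∧ w.2 < R ∧ w.1 / w.2 ∈ B} :=
    (measurableSet_lt measurable_const measurable_snd).inter
      ((measurableSet_lt measurable_snd measurable_const).inter
        ((measurable_fst.div measurable_snd) hB))
  rw [withDensity_apply _ hW, ← lintegral_indicator hW, Measure.volume_eq_prod,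
    lintegral_prod_symm' _ (hh.measurable.indicator hW),
    ← lintegral_mul_const _ (by fun_prop), ← lintegral_indicator measurableSet_Ioo]
  congr 1
  funext r
  by_cases hr : r ∈ Ioo 0 R
  · have hm : Measurable fun x : ℝ => {w : ℝ × ℝ | 0 < w.2 ∧ w.2 < R ∧ w.1 / w.2 ∈ B}.indicator h
        (x, r) := (hh.measurable.indicator hW).comp measurable_prodMk_right
    have hm' : Measurable fun s : ℝ => h (s, 1) := hh.measurable.comp measurable_prodMk_right
    rw [indicator_of_mem hr, lintegral_comp_mul_left_pos hm hr.1, pow_succ', mul_assoc,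
      ← lintegral_const_mul _ hm', ← lintegral_indicator hB]
    congr 2
    funext s
    have hiff : (r * s, r) ∈ {w : ℝ × ℝ | 0 < w.2 ∧ w.2 < R ∧ w.1 / w.2 ∈ B} ↔ s ∈ B := by
      have := hr.1.ne'
      simp only [mem_ofPred_eq, mul_div_cancel_left₀ _ this]
      exact ⟨fun h => h.2.2, fun h => ⟨hr.1, hr.2, h⟩⟩
    by_cases hs : s ∈ B
    · rw [indicator_of_mem (hiff.2 hs), indicator_of_mem hs,
        ← hh.homogeneous r hr.1]
      simp
    · rw [indicator_of_notMem (mt hiff.1 hs), indicator_of_notMem hs]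
  · rw [indicator_of_notMem hr]
    refine (lintegral_congr fun s => indicator_of_notMem ?_ _).trans lintegral_zero
    exact fun h => hr ⟨h.1, h.2.1⟩

end Sphere

/-! ### Unimodality -/

/-- A bounded quasi-concave function with bounded support becomes unimodal when its value at one
point, a limit of a maximizing sequence, is raised to its supremum. -/
theorem exists_isUnimodal_update {q : ℝ → ℝ} (hq0 : ∀ t, 0 ≤ q t) (hb : BddAbove (range q))
    {L : ℝ} (hL : ∀ t, L < |t| → q t = 0)
    (hqc : ∀ x y z, x ≤ y → y ≤ z → min (q x) (q z) ≤ q y) :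
    ∃ M S, 0 ≤ S ∧ IsUnimodal (Function.update q M S) ∧
      ∀ t, L < |t| → Function.update q M S t = 0 := by
  set S := ⨆ t, q t with hS
  have hqS : ∀ t, q t ≤ S := le_ciSup hb
  have hS0 : 0 ≤ S := (hq0 0).trans (hqS 0)
  rcases hS0.eq_or_lt with h | hSpos
  · have hz : ∀ t, q t = 0 := fun t => le_antisymm (h ▸ hqS t) (hq0 t)
    have hq : q = fun _ => 0 := funext hz
    refine ⟨0, 0, le_rfl, ⟨0, ?_⟩, fun t _ => ?_⟩
    · rw [show Function.update q 0 0 = fun _ => 0 by simp [hq]]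
      exact ⟨monotone_const.monotoneOn _, antitone_const.antitoneOn _⟩
    · simp [hq]
  have hex : ∀ n : ℕ, ∃ x, max 0 (S - 1 / ((n : ℝ) + 1)) < q x := fun n =>
    exists_lt_of_lt_ciSup (max_lt hSpos (by
      have : (0 : ℝ) < 1 / ((n : ℝ) + 1) := by positivity
      linarith))
  choose x hx using hex
  have hsupp : ∀ t, 0 < q t → t ∈ Icc (-L) L := fun t ht => by
    rw [mem_Icc, ← abs_le]
    by_contra! hc
    exact ht.ne' (hL t hc)
  obtain ⟨M, hM, φ, hφ, hlim⟩ := isCompact_Icc.tendsto_subseq fun n =>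
    hsupp (x n) ((le_max_left _ _).trans_lt (hx n))
  have hqlim : ∀ c < S, ∀ᶠ n in Filter.atTop, c < q (x (φ n)) := by
    intro c hc
    have h1 := (tendsto_one_div_add_atTop_nhds_zero_nat (𝕜 := ℝ)).comp hφ.tendsto_atTop
    filter_upwards [h1.eventually (gt_mem_nhds (sub_pos.2 hc))] with n hn
    have := (le_max_right _ _).trans_lt (hx (φ n))
    simp only [Function.comp] at hn
    linarith
  refine ⟨M, S, hS0, ⟨M, ?_, ?_⟩, ?_⟩
  · intro a ha b hb hab
    rw [mem_Iic] at ha hb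
    rcases hab.eq_or_lt with rfl | hab
    · exact le_rfl
    rw [Function.update_of_ne (hab.trans_le hb).ne]
    rcases hb.eq_or_lt with rfl | hb
    · rw [Function.update_self]; exact hqS a
    rw [Function.update_of_ne hb.ne]
    by_contra! hlt
    obtain ⟨n, hn1, hn2⟩ :=
      ((hlim.eventually (lt_mem_nhds hb)).and (hqlim _ (hlt.trans_le (hqS a)))).exists
    exact absurd (hqc a b _ hab.le (le_of_lt hn1)) (not_le.2 (lt_min hlt hn2))
  · intro a ha b hb hab
    rw [mem_Ici] at ha hb
    rcases hab.eq_or_lt with rfl | hab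
    · exact le_rfl
    rw [Function.update_of_ne (ha.trans_lt hab).ne']
    rcases ha.eq_or_lt with rfl | ha
    · rw [Function.update_self]; exact hqS b
    rw [Function.update_of_ne ha.ne']
    by_contra! hlt
    obtain ⟨n, hn1, hn2⟩ :=
      ((hlim.eventually (gt_mem_nhds ha)).and (hqlim _ (hlt.trans_le (hqS b)))).exists
    exact absurd (hqc _ a b (le_of_lt hn1) hab.le) (not_le.2 (lt_min hn2 hlt))
  · intro t ht
    have : t ≠ M := by
      rintro rfl
      exact absurd (abs_le.2 hM) (not_le.2 ht)
    rw [Function.update_of_ne this, hL t ht]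

/-- A measure on the line whose density is a logarithmically concave cone density at height one has
a unimodal density with bounded support. -/
theorem IsConeDensity.exists_isUnimodal {k : ℕ} {h : ℝ × ℝ → ℝ≥0∞} (hh : IsConeDensity k h)
    {c : ℝ≥0∞} (hc : c ≠ ∞) {ν : Measure ℝ}
    (hν : ν = volume.withDensity fun s => c * h (s, 1)) :
    ∃ p : ℝ → ℝ, IsDensityOf p ν ∧ IsUnimodal p ∧ ∃ L, ∀ t, L < |t| → p t = 0 := by
  obtain ⟨C, hC, hhC⟩ := hh.bounded
  obtain ⟨L, hL⟩ := hh.support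
  have hle : ∀ s, h (s, 1) ≤ C := fun s => by simpa using hhC (s, 1)
  have hfin : ∀ s, c * h (s, 1) ≠ ∞ := fun s =>
    ENNReal.mul_ne_top hc (ne_top_of_le_ne_top hC (hle s))
  set q : ℝ → ℝ := fun s => (c * h (s, 1)).toReal with hq
  have hqm : Measurable q :=
    (measurable_const.mul (hh.measurable.comp measurable_prodMk_right)).ennreal_toReal
  have hqL : ∀ t, L < |t| → q t = 0 := by
    intro t ht
    have : h (t, 1) = 0 := by
      by_contra hne
      have := (hL _ hne).2
      simp only [mul_one] at this
      linarith
    simp [hq, this]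
  have hqb : BddAbove (range q) := by
    refine ⟨(c * C).toReal, ?_⟩
    rintro _ ⟨s, rfl⟩
    exact ENNReal.toReal_mono (ENNReal.mul_ne_top hc hC) (mul_le_mul_right (hle s) c)
  have hqc : ∀ x y z, x ≤ y → y ≤ z → min (q x) (q z) ≤ q y := by
    intro x y z hxy hyz
    rcases hxy.eq_or_lt with rfl | hxy
    · exact min_le_left _ _
    rcases hyz.eq_or_lt with rfl | hyz
    · exact min_le_right _ _
    have hxz : 0 < z - x := by linarith
    set θ := (y - x) / (z - x) with hθ
    have h0 : 0 < θ := div_pos (by linarith) hxz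
    have h1 : θ < 1 := (div_lt_one hxz).2 (by linarith)
    have hy : (1 - θ) • (x, (1 : ℝ)) + θ • (z, (1 : ℝ)) = (y, 1) := by
      ext
      · simp [hθ]; field_simp; ring
      · simp
    have key := hh.log_concave θ h0 h1 (x, 1) (z, 1)
    rw [hy] at key
    rw [hq, ← ENNReal.toReal_min (hfin x) (hfin z)]
    refine ENNReal.toReal_mono (hfin y) ?_
    rw [← mul_min]
    gcongr
    refine le_trans ?_ key
    set m := min (h (x, 1)) (h (z, 1)) with hm
    calc m = m ^ (1 - θ) * m ^ θ := by
          rw [← ENNReal.rpow_add_of_nonneg _ _ (sub_pos.2 h1).le h0.le]; simp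
      _ ≤ _ := by
          have := (sub_pos.2 h1).le
          gcongr
          exacts [min_le_left _ _, min_le_right _ _]
  obtain ⟨M, S, hS, hu, hsupp⟩ := exists_isUnimodal_update (fun t => ENNReal.toReal_nonneg) hqb hqL
    hqc
  refine ⟨Function.update q M S, ⟨?_, ?_, ?_⟩, hu, L, hsupp⟩
  · rw [show Function.update q M S = fun t => if t = M then S else q t from
      funext fun t => Function.update_apply q M S t]
    exact Measurable.ite (measurableSet_singleton M) measurable_const hqm
  · intro t
    rcases eq_or_ne t M with rfl | ht
    · simpa using hS
    · rw [Function.update_of_ne ht]; exact ENNReal.toReal_nonneg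
  · rw [hν]
    refine withDensity_congr_ae ?_
    filter_upwards [compl_mem_ae_iff.2 (measure_singleton M)] with t ht
    rw [Function.update_of_ne ht, hq, ENNReal.ofReal_toReal (hfin t)]

theorem exists_eigenvalues_ne {n : ℕ} {T : Matrix (Fin n) (Fin n) ℂ} (hT : T.IsHermitian)
    (h : ¬ ∃ c : ℂ, T = c • (1 : Matrix (Fin n) (Fin n) ℂ)) :
    ∃ i j, hT.eigenvalues i ≠ hT.eigenvalues j := by
  by_contra! hcon
  rcases isEmpty_or_nonempty (Fin n) with he | ⟨⟨i⟩⟩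
  · exact h ⟨0, Subsingleton.elim _ _⟩
  · refine h ⟨hT.eigenvalues i, ?_⟩
    have hd : (diagonal (RCLike.ofReal ∘ hT.eigenvalues) : Matrix (Fin n) (Fin n) ℂ) =
        (hT.eigenvalues i : ℂ) • 1 := by
      rw [smul_one_eq_diagonal]
      congr 1
      funext j
      simp [hcon j i]
    conv_lhs => rw [hT.spectral_theorem, hd, map_smul, map_one]

/-- The density of the transmissivity is the planar density of `(∑ λᵢ xᵢ, ∑ xᵢ)` at height one, up
to a constant. -/
theorem exists_isUnimodal_transmissivityLaw {m n : ℕ} (hn : 2 ≤ n) (τ : Matrix (Fin m) (Fin n) ℂ)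
    (hτ : ¬ ∃ c : ℂ, transmittanceMatrix τ = c • (1 : Matrix (Fin n) (Fin n) ℂ)) :
    ∃ p : ℝ → ℝ, IsDensityOf p (transmissivityLaw τ) ∧ IsUnimodal p ∧
      ∃ L, ∀ t, L < |t| → p t = 0 := by
  obtain ⟨k, rfl⟩ : ∃ k, n = k + 2 := ⟨n - 2, by omega⟩
  obtain ⟨h, hh, hl⟩ := exists_isConeDensity k _
    (exists_eigenvalues_ne (isHermitian_transmittanceMatrix τ) hτ)
  obtain ⟨K, hK, hlaw⟩ := exists_transmissivityLaw_apply_eq (by omega) τ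
  set I : ℝ≥0∞ := ∫⁻ r in Ioo 0 Real.pi, ENNReal.ofReal r ^ (k + 1) with hI
  have hIT : I ≠ ∞ := by
    have : I ≤ ∫⁻ r in Ioo 0 Real.pi, ENNReal.ofReal Real.pi ^ (k + 1) := by
      refine setLIntegral_mono' measurableSet_Ioo fun r hr => ?_
      gcongr
      exact hr.2.le
    refine ne_top_of_le_ne_top ?_ this
    rw [lintegral_const]
    simp [ENNReal.mul_eq_top]
  refine hh.exists_isUnimodal (ENNReal.mul_ne_top hK hIT) ?_
  ext B hB
  have hm : Measurable fun s : ℝ => h (s, 1) := hh.measurable.comp measurable_prodMk_right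
  rw [hlaw B hB, hl, hh.withDensity_apply_ratio hB, withDensity_apply _ hB,
    lintegral_const_mul _ hm, mul_assoc]

/-! ### A test function for tails of unimodal laws -/

/-- The test function `A y² - B - 1_{y > 1}`, whose expectation compares a second moment with a tail
probability. -/
def tailTest (A B y : ℝ) : ℝ := A * y ^ 2 - B - (Ioi (1 : ℝ)).indicator 1 y

/-- The primitive of `tailTest A B`. -/
def tailTestPrimitive (A B y : ℝ) : ℝ := A * y ^ 3 / 3 - B * y - max (y - 1) 0

theorem integral_indicator_Ioi_one (c d : ℝ) :
    ∫ y in c..d, (Ioi (1 : ℝ)).indicator 1 y = max (d - 1) 0 - max (c - 1) 0 := by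
  have key : ∀ c d : ℝ, c ≤ d →
      ∫ y in c..d, (Ioi (1 : ℝ)).indicator (1 : ℝ → ℝ) y = max (d - 1) 0 - max (c - 1) 0 := by
    intro c d hcd
    rw [intervalIntegral.integral_of_le hcd, integral_indicator_one measurableSet_Ioi,
      measureReal_restrict_apply measurableSet_Ioi, inter_comm, Ioc_inter_Ioi, Real.volume_real_Ioc]
    rcases le_total c 1 with h1 | h1 <;> rcases le_total d 1 with h2 | h2 <;>
      simp [h1, h2, hcd, le_trans h1]
  rcases le_total c d with h | h
  · exact key c d h
  · rw [intervalIntegral.integral_symm, key d c h]; ring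

theorem intervalIntegrable_indicator_Ioi_one (c d : ℝ) :
    IntervalIntegrable ((Ioi (1 : ℝ)).indicator (1 : ℝ → ℝ)) volume c d := by
  rw [intervalIntegrable_iff]
  exact (integrableOn_const (by simp [uIoc])).indicator measurableSet_Ioi

theorem integral_tailTest (A B c d : ℝ) :
    ∫ y in c..d, tailTest A B y = tailTestPrimitive A B d - tailTestPrimitive A B c := by
  unfold tailTest tailTestPrimitive
  rw [intervalIntegral.integral_sub (Continuous.intervalIntegrable (by fun_prop) _ _)
    (intervalIntegrable_indicator_Ioi_one c d), integral_indicator_Ioi_one,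
    intervalIntegral.integral_sub (Continuous.intervalIntegrable (by fun_prop) _ _)
      (Continuous.intervalIntegrable (by fun_prop) _ _)]
  simp
  ring

/-- For each mode `M` there are coefficients for which the test function has nonnegative mean over
every interval with end point `M`; its expectation under a law with that mode is then nonnegative.
The two bounds on the coefficients turn this into `P(Y > 1) ≤ 4/9 E[Y²]` when `E[Y²] ≤ 3/8`. -/
theorem exists_tailTestPrimitive_le (M : ℝ) :
    ∃ A B : ℝ, 4 / 9 ≤ A ∧ A * (3 / 8) - B ≤ 1 / 6 ∧
      (∀ b, M ≤ b → tailTestPrimitive A B M ≤ tailTestPrimitive A B b) ∧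
      ∀ b, b ≤ M → tailTestPrimitive A B b ≤ tailTestPrimitive A B M := by
  unfold tailTestPrimitive
  rcases le_or_gt M 0 with hM | hM
  · refine ⟨4 / 9, 0, le_rfl, by norm_num, fun b hb => ?_, fun b hb => ?_⟩
    · have hMb : M ^ 3 ≤ b ^ 3 := (Odd.strictMono_pow (by decide)).monotone hb
      have hM3 : M ^ 3 ≤ 0 := by
        have := (Odd.strictMono_pow (R := ℝ) (n := 3) (by decide)).monotone hM
        simpa using this
      rw [max_eq_right (by linarith : M - 1 ≤ 0)]
      rcases le_total b 1 with h1 | h1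
      · rw [max_eq_right (by linarith : b - 1 ≤ 0)]; linarith
      · rw [max_eq_left (by linarith : 0 ≤ b - 1)]
        -- `4 b³ - 27 (b - 1) = (2 b - 3)² (b + 3)`, with equality at `b = 3 / 2`
        nlinarith [mul_nonneg (sq_nonneg (2 * b - 3)) (by linarith : 0 ≤ b + 3)]
    · have hMb : b ^ 3 ≤ M ^ 3 := (Odd.strictMono_pow (by decide)).monotone hb
      rw [max_eq_right (by linarith : M - 1 ≤ 0), max_eq_right (by linarith : b - 1 ≤ 0)]
      linarith
  rcases le_or_gt M 1 with hM1 | hM1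
  · have hM2 : M ^ 2 ≤ 1 := by nlinarith
    have hden : 0 < 9 - 6 * M ^ 2 := by linarith
    -- With `B = A M² / 4`, the integral of `A y² - B` from `M` to `b` is `b - M` times a square;
    -- `A` is then determined by `A * (3 / 8) - B = 1 / 6`.
    obtain ⟨A, hA⟩ : ∃ A, A = 4 / (9 - 6 * M ^ 2) := ⟨_, rfl⟩
    have hA' : A * (9 - 6 * M ^ 2) = 4 := by rw [hA]; field_simp
    have hA0 : 0 < A := by rw [hA]; positivity
    have hA49 : 4 / 9 ≤ A := by
      rw [hA]
      apply div_le_div_of_nonneg_left (by norm_num) hden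
      nlinarith [sq_nonneg M]
    refine ⟨A, A * M ^ 2 / 4, hA49, by linarith, fun b hb => ?_, fun b hb => ?_⟩
    · rw [max_eq_right (by linarith : M - 1 ≤ 0)]
      have hid : A * b ^ 3 / 3 - A * M ^ 2 / 4 * b - (A * M ^ 3 / 3 - A * M ^ 2 / 4 * M) =
          A * ((b - M) * (2 * b + M) ^ 2) / 12 := by ring
      rcases le_total b 1 with h1 | h1
      · rw [max_eq_right (by linarith : b - 1 ≤ 0)]
        have : 0 ≤ A * ((b - M) * (2 * b + M) ^ 2) / 12 := by
          have := sub_nonneg.2 hb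
          positivity
        linarith
      · rw [max_eq_left (by linarith : 0 ≤ b - 1)]
        have hpoly : 3 * (b - 1) * (9 - 6 * M ^ 2) ≤ (b - M) * (2 * b + M) ^ 2 := by
          have e : (b - M) * (2 * b + M) ^ 2 - 3 * (b - 1) * (9 - 6 * M ^ 2) =
              (2 * b - 3) ^ 2 * (b + 3) + M ^ 2 * (15 * b - 18 - M) := by ring
          have e1 : M ^ 2 * (15 * b - 19) ≤ M ^ 2 * (15 * b - 18 - M) :=
            mul_le_mul_of_nonneg_left (by linarith) (sq_nonneg M)
          rcases le_total (15 * b - 19) 0 with h2 | h2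
          · have e2 : 15 * b - 19 ≤ M ^ 2 * (15 * b - 19) := by nlinarith
            -- what remains is the value at `M = 1`, namely `4 (b - 1)² (b + 2)`
            have e3 : 0 ≤ 4 * (b - 1) ^ 2 * (b + 2) := by positivity
            nlinarith
          · have e2 : 0 ≤ M ^ 2 * (15 * b - 19) := by positivity
            have e3 : 0 ≤ (2 * b - 3) ^ 2 * (b + 3) := by positivity
            linarith
        have : A * (3 * (b - 1) * (9 - 6 * M ^ 2)) ≤ A * ((b - M) * (2 * b + M) ^ 2) := by
          gcongr
        have e4 : A * (3 * (b - 1) * (9 - 6 * M ^ 2)) = 12 * (b - 1) := by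
          rw [mul_left_comm, hA']; ring
        linarith
    · rw [max_eq_right (by linarith : M - 1 ≤ 0), max_eq_right (by linarith : b - 1 ≤ 0)]
      have hid : A * M ^ 3 / 3 - A * M ^ 2 / 4 * M - (A * b ^ 3 / 3 - A * M ^ 2 / 4 * b) =
          A * ((M - b) * (2 * b + M) ^ 2) / 12 := by ring
      have : 0 ≤ A * ((M - b) * (2 * b + M) ^ 2) / 12 := by
        have := sub_nonneg.2 hb
        positivity
      linarith
  · refine ⟨4 / 3, 1 / 3, by norm_num, by norm_num, fun b hb => ?_, fun b hb => ?_⟩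
    · rw [max_eq_left (by linarith : 0 ≤ M - 1), max_eq_left (by linarith : 0 ≤ b - 1)]
      nlinarith [mul_nonneg (sub_nonneg.2 hb) (by nlinarith : 0 ≤ b ^ 2 + b * M + M ^ 2 - 3)]
    · rw [max_eq_left (by linarith : 0 ≤ M - 1)]
      rcases le_total b 1 with h1 | h1
      · rw [max_eq_right (by linarith : b - 1 ≤ 0)]
        -- `4 b³ - 3 b ≤ 1` and `4 M³ - 12 M + 8 ≥ 0` factor as `(b - 1) (2 b + 1)² ≤ 0` and
        -- `4 (M - 1)² (M + 2) ≥ 0`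
        nlinarith [mul_nonneg (sub_nonneg.2 h1) (sq_nonneg (2 * b + 1)),
          mul_nonneg (sq_nonneg (M - 1)) (by linarith : 0 ≤ M + 2)]
      · rw [max_eq_left (by linarith : 0 ≤ b - 1)]
        nlinarith [mul_nonneg (sub_nonneg.2 hb) (by nlinarith : 0 ≤ b ^ 2 + b * M + M ^ 2 - 3)]

/-! ### The one-sided Vysochanskij–Petunin inequality -/

theorem setIntegral_nonneg_of_ordConnected {g : ℝ → ℝ} {M : ℝ}
    (hg : ∀ c d, c ≤ M → M ≤ d → 0 ≤ ∫ x in c..d, g x) {E : Set ℝ} (hE : E.OrdConnected)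
    (hb : BddBelow E) (ha : BddAbove E) (hM : M ∈ E) : 0 ≤ ∫ x in E, g x := by
  have h1 : sInf E ≤ M := csInf_le hb hM
  have h2 : M ≤ sSup E := le_csSup ha hM
  have hsub : Ioo (sInf E) (sSup E) ⊆ E := by
    intro x hx
    obtain ⟨a, haE, hax⟩ := exists_lt_of_csInf_lt ⟨M, hM⟩ hx.1
    obtain ⟨b, hbE, hxb⟩ := exists_lt_of_lt_csSup ⟨M, hM⟩ hx.2
    exact hE.out haE hbE ⟨hax.le, hxb.le⟩
  have hsup : E ⊆ Icc (sInf E) (sSup E) := fun x hx => ⟨csInf_le hb hx, le_csSup ha hx⟩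
  have hae : E =ᵐ[volume] Ioc (sInf E) (sSup E) :=
    (hsup.eventuallyLE.trans Ioc_ae_eq_Icc.symm.le).antisymm
      (Ioo_ae_eq_Ioc.symm.le.trans hsub.eventuallyLE)
  rw [setIntegral_congr_set hae, ← intervalIntegral.integral_of_le (h1.trans h2)]
  exact hg _ _ h1 h2

/-- A function with nonnegative integral over every interval containing the mode has nonnegative
integral against a unimodal density, by decomposition into the superlevel sets of the density. -/
theorem integral_mul_nonneg_of_unimodal {g p : ℝ → ℝ} {M L : ℝ} (hpm : Measurable p)
    (hp0 : ∀ t, 0 ≤ p t) (hmono : MonotoneOn p (Iic M)) (hanti : AntitoneOn p (Ici M))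
    (hL : ∀ t, L < |t| → p t = 0) (hgi : IntegrableOn g (Icc (-L) L))
    (hg : ∀ c d, c ≤ M → M ≤ d → 0 ≤ ∫ x in c..d, g x) : 0 ≤ ∫ x, g x * p x := by
  have hmax : ∀ x, p x ≤ p M := fun x => by
    rcases le_total x M with h | h
    · exact hmono h self_mem_Iic h
    · exact hanti self_mem_Ici h h
  have hsupp : ∀ x, 0 < p x → x ∈ Icc (-L) L := fun t ht => by
    rw [mem_Icc, ← abs_le]
    by_contra! hc
    exact ht.ne' (hL t hc)
  have hlayer : ∀ x, g x * p x =
      ∫ y in Ioc 0 (p M), {z : ℝ × ℝ | z.2 < p z.1}.indicator (fun z => g z.1) (x, y) := by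
    intro x
    have h1 : (fun y => {z : ℝ × ℝ | z.2 < p z.1}.indicator (fun z => g z.1) (x, y)) =
        (Iio (p x)).indicator fun _ => g x := by
      funext y
      by_cases hy : y < p x <;> simp [indicator, hy]
    have h2 : Ioc 0 (p M) ∩ Iio (p x) = Ioo 0 (p x) := by
      ext y
      simp only [mem_inter_iff, mem_Ioc, mem_Iio, mem_Ioo]
      exact ⟨fun h => ⟨h.1.1, h.2⟩, fun h => ⟨⟨h.1, h.2.le.trans (hmax x)⟩, h.2⟩⟩
    rw [h1, setIntegral_indicator measurableSet_Iio, h2, setIntegral_const]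
    simp [hp0 x, mul_comm]
  have hset : MeasurableSet {z : ℝ × ℝ | z.2 < p z.1} :=
    measurableSet_lt measurable_snd (hpm.comp measurable_fst)
  have hint : Integrable ({z : ℝ × ℝ | z.2 < p z.1}.indicator fun z => g z.1)
      ((volume.restrict (Icc (-L) L)).prod (volume.restrict (Ioc 0 (p M)))) :=
    (Integrable.comp_fst hgi _).indicator hset
  rw [← setIntegral_eq_integral_of_forall_compl_eq_zero (s := Icc (-L) L)]
  · simp only [hlayer]
    rw [integral_integral_swap (f := fun x y =>
      {z : ℝ × ℝ | z.2 < p z.1}.indicator (fun z => g z.1) (x, y)) hint]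
    refine setIntegral_nonneg measurableSet_Ioc fun y hy => ?_
    have h1 : (fun x => {z : ℝ × ℝ | z.2 < p z.1}.indicator (fun z => g z.1) (x, y)) =
        {x | y < p x}.indicator g := by
      funext x
      by_cases hy : y < p x <;> simp [indicator, hy]
    have hE : {x | y < p x} ⊆ Icc (-L) L := fun x hx => hsupp x (hy.1.trans hx)
    rw [h1, setIntegral_indicator (measurableSet_lt measurable_const hpm),
      inter_eq_self_of_subset_right hE]
    rcases hy.2.eq_or_lt with rfl | hyM
    · have : {x | p M < p x} = ∅ := by
        ext x; simpa using hmax x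
      simp [this]
    · refine setIntegral_nonneg_of_ordConnected hg ⟨fun a ha b hb x hx => ?_⟩
        (bddBelow_Icc.mono hE) (bddAbove_Icc.mono hE) hyM
      rcases le_total x M with h | h
      · exact lt_of_lt_of_le ha (hmono (hx.1.trans h) h hx.1)
      · exact lt_of_lt_of_le hb (hanti h (h.trans hx.2) hx.2)
  · intro x hx
    have : p x = 0 := by
      by_contra hne
      exact hx (hsupp x ((hp0 x).lt_of_ne' hne))
    simp [this]

theorem IsDensityOf.integral_eq {p : ℝ → ℝ} {ν : Measure ℝ} (hp : IsDensityOf p ν) (f : ℝ → ℝ) :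
    ∫ x, f x ∂ν = ∫ x, f x * p x := by
  rw [hp.eq_withDensity, integral_withDensity_eq_integral_toReal_smul
    hp.measurable.ennreal_ofReal (by simp)]
  simp [ENNReal.toReal_ofReal (hp.nonneg _), mul_comm]

theorem IsDensityOf.integrable_of_continuous {p : ℝ → ℝ} {ν : Measure ℝ} [IsFiniteMeasure ν]
    (hp : IsDensityOf p ν) {L : ℝ} (hL : ∀ t, L < |t| → p t = 0) {f : ℝ → ℝ} (hf : Continuous f) :
    Integrable f ν := by
  obtain ⟨C, hC⟩ := (isCompact_Icc (a := -L) (b := L)).exists_bound_of_continuousOn hf.continuousOn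
  refine Integrable.of_bound hf.aestronglyMeasurable C ?_
  have h0 : ν (Icc (-L) L)ᶜ = 0 := by
    rw [hp.eq_withDensity, withDensity_apply _ measurableSet_Icc.compl]
    refine (setLIntegral_congr_fun measurableSet_Icc.compl fun t ht => ?_).trans lintegral_zero
    rw [mem_compl_iff, mem_Icc, ← abs_le, not_le] at ht
    simp [hL t ht]
  filter_upwards [compl_mem_ae_iff.2 h0] with t ht
  exact hC t (by simpa using ht)

/-- A one-sided Vysochanskij–Petunin inequality: for a unimodal law, a second moment of at most
`3 / 8` about any point controls the tail beyond unit distance with the constant `4 / 9`. The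
normalization by `k` covers both tails, according to its sign. -/
theorem IsDensityOf.measureReal_tail_le {p : ℝ → ℝ} {ν : Measure ℝ} [IsProbabilityMeasure ν]
    (hp : IsDensityOf p ν) (hu : IsUnimodal p) {L : ℝ} (hL : ∀ t, L < |t| → p t = 0) {α k : ℝ}
    (hk : k ≠ 0) (he : ∫ t, ((t - α) / k) ^ 2 ∂ν ≤ 3 / 8) :
    ν.real {t | 1 < (t - α) / k} ≤ 4 / 9 * ∫ t, ((t - α) / k) ^ 2 ∂ν := by
  obtain ⟨M, hmono, hanti⟩ := hu
  obtain ⟨A, B, hA, hAB, hup, hdown⟩ := exists_tailTestPrimitive_le ((M - α) / k)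
  have hcomp : ∀ c d, ∫ x in c..d, tailTest A B ((x - α) / k) =
      k * (tailTestPrimitive A B ((d - α) / k) - tailTestPrimitive A B ((c - α) / k)) := by
    intro c d
    simp only [sub_div]
    rw [intervalIntegral.integral_comp_div_sub (tailTest A B) hk, integral_tailTest, smul_eq_mul]
  have hset : MeasurableSet {t : ℝ | 1 < (t - α) / k} :=
    measurableSet_lt measurable_const (by fun_prop)
  have hind : ∀ t, tailTest A B ((t - α) / k) =
      A * ((t - α) / k) ^ 2 - B - {t : ℝ | 1 < (t - α) / k}.indicator 1 t := fun t => rfl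
  have hcont : Continuous fun t => A * ((t - α) / k) ^ 2 - B := by fun_prop
  have key : 0 ≤ ∫ x, tailTest A B ((x - α) / k) * p x := by
    refine integral_mul_nonneg_of_unimodal hp.measurable hp.nonneg hmono hanti hL ?_ ?_
    · simp only [hind]
      exact (hcont.integrableOn_Icc).sub ((integrableOn_const (by simp)).indicator hset)
    · intro c d hc hd
      rw [hcomp]
      rcases hk.lt_or_gt with hneg | hpos
      · have h1 := hdown ((d - α) / k) (div_le_div_of_nonpos_of_le hneg.le (by linarith))
        have h2 := hup ((c - α) / k) (div_le_div_of_nonpos_of_le hneg.le (by linarith))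
        exact mul_nonneg_of_nonpos_of_nonpos hneg.le (by linarith)
      · have h1 := hup ((d - α) / k) (by gcongr)
        have h2 := hdown ((c - α) / k) (by gcongr)
        exact mul_nonneg hpos.le (by linarith)
  rw [← hp.integral_eq fun x => tailTest A B ((x - α) / k)] at key
  simp only [hind] at key
  have hi1 : Integrable (fun t => ((t - α) / k) ^ 2) ν :=
    hp.integrable_of_continuous hL (by fun_prop)
  have hone : Integrable ({t : ℝ | 1 < (t - α) / k}.indicator (1 : ℝ → ℝ)) ν :=
    (integrable_const (1 : ℝ)).indicator hset
  rw [integral_sub (hp.integrable_of_continuous hL hcont) hone, integral_sub (hi1.const_mul A)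
    (integrable_const B), integral_const_mul, integral_indicator_one hset] at key
  simp only [integral_const, probReal_univ, one_smul] at key
  -- `key` bounds the tail by `A e - B`, where `e` is the second moment, and
  -- `A e - B ≤ 4/9 e + (A - 4/9) (3/8) - B ≤ 4/9 e`.
  nlinarith [mul_nonneg (sub_nonneg.2 hA) (sub_nonneg.2 he)]

/-- The tail of a unimodal law at signed distance `d` from its mean. The set is the tail beyond
`μ + d`: the upper one for positive `d` and the lower one for negative `d`. -/
theorem IsDensityOf.measureReal_tail_mean_le {p : ℝ → ℝ} {ν : Measure ℝ} [IsProbabilityMeasure ν]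
    (hp : IsDensityOf p ν) (hu : IsUnimodal p) {L : ℝ} (hL : ∀ t, L < |t| → p t = 0) {μ V d : ℝ}
    (hμ : μ = ∫ t, t ∂ν) (hV : V = ∫ t, (t - μ) ^ 2 ∂ν) (hd : d ≠ 0) (hVd : 5 * V ≤ 3 * d ^ 2) :
    ν.real {t | 1 < (t - (μ - V / d)) / (d + V / d)} ≤ 4 / 9 * (V / (V + d ^ 2)) := by
  have hV0 : 0 ≤ V := hV ▸ integral_nonneg fun t => sq_nonneg _
  have hd2 : 0 < d ^ 2 := by positivity
  have hk : d + V / d ≠ 0 := by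
    have : d + V / d = (V + d ^ 2) / d := by field_simp; ring
    rw [this]
    exact div_ne_zero (by positivity) hd
  have hi : ∀ {f : ℝ → ℝ}, Continuous f → Integrable f ν := hp.integrable_of_continuous hL
  -- The second moment about the shifted centre `μ - V / d` is `V + (V / d)²`.
  have hE : ∫ t, ((t - (μ - V / d)) / (d + V / d)) ^ 2 ∂ν = V / (V + d ^ 2) := by
    have h1 : ∀ t, ((t - (μ - V / d)) / (d + V / d)) ^ 2 =
        ((d + V / d) ^ 2)⁻¹ * ((t - μ) ^ 2 + (2 * (V / d) * (t - μ) + (V / d) ^ 2)) := by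
      intro t
      rw [div_pow]
      ring
    simp only [h1]
    rw [integral_const_mul, integral_add (hi (by fun_prop)) (hi (by fun_prop)),
      integral_add (hi (by fun_prop)) (hi (by fun_prop)), integral_const_mul,
      integral_sub (hi (by fun_prop)) (hi (by fun_prop)), ← hV, ← hμ]
    simp only [integral_const, probReal_univ, one_smul, sub_self, mul_zero, zero_add]
    have : V + d ^ 2 ≠ 0 := by positivity
    field_simp
    ring
  have := hp.measureReal_tail_le hu hL (α := μ - V / d) hk (by
    rw [hE, div_le_iff₀ (by positivity)]; linarith)
  rwa [hE] at this

/-! ### Tails of the transmissivity -/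

section Tails

variable {m n : ℕ}

/-- For a scalar transmittance matrix the transmissivity is constant. -/
theorem transmissivityLaw_eq_dirac (hn : 1 ≤ n) {τ : Matrix (Fin m) (Fin n) ℂ} {c : ℂ}
    (hc : transmittanceMatrix τ = c • (1 : Matrix (Fin n) (Fin n) ℂ)) :
    transmissivityLaw τ = Measure.dirac c.re := by
  have := isProbabilityMeasure_uniformSphere hn
  have h : transmissivity τ = fun _ => c.re := by
    funext a
    have hna : ‖(a : EuclideanSpace ℂ (Fin n))‖ = 1 := norm_eq_of_mem_sphere a
    have h1 : star (a : EuclideanSpace ℂ (Fin n)).ofLp ⬝ᵥ (a : EuclideanSpace ℂ (Fin n)).ofLp =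
        1 := by
      rw [dotProduct_comm, ← EuclideanSpace.inner_eq_star_dotProduct, inner_self_eq_norm_sq_to_K,
        hna]
      simp
    rw [transmissivity, hc, smul_mulVec, one_mulVec, dotProduct_smul, h1, smul_eq_mul, mul_one]
  rw [transmissivityLaw, h, Measure.map_const]
  simp

theorem transmissivityStd_sq (τ : Matrix (Fin m) (Fin n) ℂ) :
    transmissivityStd τ ^ 2 = transmissivityVar τ :=
  Real.sq_sqrt (integral_nonneg fun _ => sq_nonneg _)

/-- Both tails of the transmissivity at once: the set is `(μ + d, ∞)` for positive `d` and
`(-∞, μ + d)` for negative `d`. -/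
theorem transmissivityLaw_tail_le (hn : 2 ≤ n) (τ : Matrix (Fin m) (Fin n) ℂ) {d : ℝ} (hd : d ≠ 0)
    (hVd : 5 * transmissivityVar τ ≤ 3 * d ^ 2) :
    (transmissivityLaw τ).real {t | 0 < (t - (transmissivityMean τ + d)) / d} ≤
      4 / 9 * (transmissivityVar τ / (transmissivityVar τ + d ^ 2)) := by
  have hprob := isProbabilityMeasure_transmissivityLaw (by omega : 1 ≤ n) τ
  by_cases hτ : ∃ c : ℂ, transmittanceMatrix τ = c • (1 : Matrix (Fin n) (Fin n) ℂ)
  · obtain ⟨c, hc⟩ := hτ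
    have hlaw := transmissivityLaw_eq_dirac (by omega : 1 ≤ n) hc
    have hmean : transmissivityMean τ = c.re := by
      rw [transmissivityMean, hlaw, integral_dirac]
    have hvar : transmissivityVar τ = 0 := by
      rw [transmissivityVar, hlaw, integral_dirac, hmean]; simp
    have hset : MeasurableSet {t : ℝ | 0 < (t - (c.re + d)) / d} :=
      measurableSet_lt measurable_const (by fun_prop)
    have hnot : c.re ∉ {t : ℝ | 0 < (t - (c.re + d)) / d} := by
      simp [hd]
    rw [hvar, hlaw, hmean, measureReal_def, Measure.dirac_apply' _ hset, indicator_of_notMem hnot]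
    simp
  · obtain ⟨p, hp, hu, L, hL⟩ := exists_isUnimodal_transmissivityLaw hn τ hτ
    have key := hp.measureReal_tail_mean_le hu hL (d := d) (μ := transmissivityMean τ)
      (V := transmissivityVar τ) rfl rfl hd hVd
    have hV0 : 0 ≤ transmissivityVar τ := integral_nonneg fun _ => sq_nonneg _
    convert key using 3
    ext t
    set V := transmissivityVar τ
    set μ := transmissivityMean τ
    have hpos : 0 < 1 + V / d ^ 2 := by positivity
    have e : (t - (μ - V / d)) / (d + V / d) - 1 = (t - (μ + d)) / d / (1 + V / d ^ 2) := by
      have h1 : d + V / d ≠ 0 := by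
        have : d + V / d = d * (1 + V / d ^ 2) := by field_simp
        rw [this]
        exact mul_ne_zero hd hpos.ne'
      have h2 : d ^ 2 + V ≠ 0 := by positivity
      field_simp
      ring
    rw [← sub_pos (b := (1 : ℝ)), e, div_pos_iff_of_pos_right hpos]

theorem pos_and_five_mul_sq_le {σ d : ℝ} (hd : √(5 / 3) * σ < d) (hσ : 0 ≤ σ) :
    0 < d ∧ 5 * σ ^ 2 ≤ 3 * d ^ 2 := by
  have h0 : 0 ≤ √(5 / 3) * σ := by positivity
  have h1 : (√(5 / 3) * σ) ^ 2 ≤ d ^ 2 := by gcongr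
  rw [mul_pow, Real.sq_sqrt (by norm_num)] at h1
  exact ⟨h0.trans_lt hd, by linarith⟩

theorem transmissivityLaw_lower_tail_le (hn : 2 ≤ n) (τ : Matrix (Fin m) (Fin n) ℂ) {t_a : ℝ}
    (ht : t_a < transmissivityMean τ - √(5 / 3) * transmissivityStd τ) :
    (transmissivityLaw τ).real {t | t < t_a} ≤
      4 / 9 * (transmissivityStd τ ^ 2 /
        (transmissivityStd τ ^ 2 + (transmissivityMean τ - t_a) ^ 2)) := by
  obtain ⟨h1, h2⟩ := pos_and_five_mul_sq_le (σ := transmissivityStd τ)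
    (d := transmissivityMean τ - t_a) (by linarith) (Real.sqrt_nonneg _)
  rw [transmissivityStd_sq] at h2 ⊢
  have key := transmissivityLaw_tail_le hn τ (d := t_a - transmissivityMean τ) (by linarith)
    (by linarith [sub_sq_comm t_a (transmissivityMean τ)])
  rw [sub_sq_comm] at key
  convert key using 3
  ext t
  rw [add_sub_cancel, ← neg_div_neg_eq, div_pos_iff_of_pos_right (by linarith), neg_sub, sub_pos]

theorem transmissivityLaw_upper_tail_le (hn : 2 ≤ n) (τ : Matrix (Fin m) (Fin n) ℂ) {t_b : ℝ}
    (ht : transmissivityMean τ + √(5 / 3) * transmissivityStd τ < t_b) :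
    (transmissivityLaw τ).real {t | t_b < t} ≤
      4 / 9 * (transmissivityStd τ ^ 2 /
        (transmissivityStd τ ^ 2 + (t_b - transmissivityMean τ) ^ 2)) := by
  obtain ⟨h1, h2⟩ := pos_and_five_mul_sq_le (σ := transmissivityStd τ)
    (d := t_b - transmissivityMean τ) (by linarith) (Real.sqrt_nonneg _)
  rw [transmissivityStd_sq] at h2 ⊢
  have key := transmissivityLaw_tail_le hn τ h1.ne' h2
  convert key using 3
  ext t
  rw [add_sub_cancel, div_pos_iff_of_pos_right h1, sub_pos]

/-- A transmissivity of zero variance equals its mean almost surely. -/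
theorem transmissivityLaw_ne_mean_eq_zero (hn : 2 ≤ n) {τ : Matrix (Fin m) (Fin n) ℂ}
    (h : transmissivityVar τ = 0) : transmissivityLaw τ {t | t ≠ transmissivityMean τ} = 0 := by
  have hprob := isProbabilityMeasure_transmissivityLaw (by omega : 1 ≤ n) τ
  have hint : Integrable (fun t => (t - transmissivityMean τ) ^ 2) (transmissivityLaw τ) := by
    have := isProbabilityMeasure_uniformSphere (by omega : 1 ≤ n)
    rw [transmissivityLaw, integrable_map_measure (by fun_prop)
      (continuous_transmissivity τ).measurable.aemeasurable]
    refine Continuous.integrable_of_hasCompactSupport ?_ (HasCompactSupport.of_compactSpace _)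
    exact ((continuous_transmissivity τ).sub continuous_const).pow 2
  have h0 := (integral_eq_zero_iff_of_nonneg (fun t => sq_nonneg _) hint).1 h
  refine measure_mono_null (fun t ht => ?_) (ae_iff.1 h0)
  simpa [sub_eq_zero] using ht

end Tails

end

theorem mainTheorem6 {m n : ℕ} (hn : 3 ≤ n) (τ : Matrix (Fin m) (Fin n) ℂ) :
    ((¬ ∃ c : ℂ, transmittanceMatrix τ = c • (1 : Matrix (Fin n) (Fin n) ℂ)) →
      ∃ p : ℝ → ℝ, IsDensityOf p (transmissivityLaw τ) ∧ IsUnimodal p) ∧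
    (∀ t_a : ℝ, t_a < transmissivityMean τ - √(5 / 3) * transmissivityStd τ →
      (transmissivityLaw τ).real {t | t < t_a} ≤
        4 / 9 * (transmissivityStd τ ^ 2 /
          (transmissivityStd τ ^ 2 + (transmissivityMean τ - t_a) ^ 2))) ∧
    (∀ t_b : ℝ, transmissivityMean τ + √(5 / 3) * transmissivityStd τ < t_b →
      (transmissivityLaw τ).real {t | t_b < t} ≤
        4 / 9 * (transmissivityStd τ ^ 2 /
          (transmissivityStd τ ^ 2 + (t_b - transmissivityMean τ) ^ 2))) ∧
    (transmissivityLaw τ).real {t | 3 * transmissivityStd τ < transmissivityMean τ - t} ≤ 0.0445 ∧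
    (transmissivityLaw τ).real {t | 3 * transmissivityStd τ < t - transmissivityMean τ} ≤ 0.0445 := by
  have hn2 : 2 ≤ n := by omega
  have hs : √(5 / 3 : ℝ) < 3 := (Real.sqrt_lt' (by norm_num)).2 (by norm_num)
  refine ⟨fun hτ => ?_, fun _ => transmissivityLaw_lower_tail_le hn2 τ,
    fun _ => transmissivityLaw_upper_tail_le hn2 τ, ?_⟩
  · obtain ⟨p, hp, hu, -⟩ := exists_isUnimodal_transmissivityLaw hn2 τ hτ
    exact ⟨p, hp, hu⟩
  have hσ : 0 ≤ transmissivityStd τ := Real.sqrt_nonneg _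
  rcases hσ.eq_or_lt with h0 | hpos
  · have hnull := transmissivityLaw_ne_mean_eq_zero (τ := τ) hn2 (by
      rw [← transmissivityStd_sq, ← h0]; simp)
    have hzero : ∀ s ⊆ {t | t ≠ transmissivityMean τ}, (transmissivityLaw τ).real s ≤ 0.0445 := by
      intro s hs
      rw [measureReal_def, measure_mono_null hs hnull]
      norm_num
    rw [← h0]
    constructor
    · refine hzero _ fun t ht => ?_
      rintro rfl
      simp at ht
    · refine hzero _ fun t ht => ?_
      rintro rfl
      simp at ht
  · have hval : 4 / 9 * (transmissivityStd τ ^ 2 /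
        (transmissivityStd τ ^ 2 + (3 * transmissivityStd τ) ^ 2)) ≤ (0.0445 : ℝ) := by
      have : transmissivityStd τ ^ 2 / (transmissivityStd τ ^ 2 + (3 * transmissivityStd τ) ^ 2) =
          1 / 10 := by
        field_simp
        norm_num
      rw [this]
      norm_num
    have hlt : √(5 / 3) * transmissivityStd τ < 3 * transmissivityStd τ :=
      mul_lt_mul_of_pos_right hs hpos
    constructor
    · have key := transmissivityLaw_lower_tail_le hn2 τ
        (t_a := transmissivityMean τ - 3 * transmissivityStd τ) (by linarith)
      rw [sub_sub_cancel] at key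
      refine le_trans (le_of_eq ?_) (key.trans hval)
      congr 1
      ext t
      simp only [mem_ofPred_eq]
      constructor <;> intro h <;> linarith
    · have key := transmissivityLaw_upper_tail_le hn2 τ
        (t_b := transmissivityMean τ + 3 * transmissivityStd τ) (by linarith)
      rw [add_sub_cancel_left] at key
      refine le_trans (le_of_eq ?_) (key.trans hval)
      congr 1
      ext t
      simp only [mem_ofPred_eq]
      constructor <;> intro h <;> linarith
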